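/- Let $W$ be a model of $\mathsf{ZFC}$ and let $V$ be an inner model of $W$, that is, a transitive subclass of $W$ that contains all ordinals of $W$ and is itself a model of $\mathsf{ZFC}$. Suppose that, in $V$, $\theta < \kappa < \lambda$ are cardinals with $\theta$ and $\kappa$ regular (and infinite) and $\lambda \le \kappa^{+\theta^{+}}$ (both $\theta^+$ and $\kappa^{+\theta^+}$ being computed in $V$), and that $\mathrm{cf}^W(\nu) = \theta$ for every $\nu \in [\kappa,\lambda)$ that is a regular cardinal in $V$. Then for every $\nu \in [\kappa,\lambda)$ that is a cardinal in $V$ there is, in $W$, a set $Y_\nu \subseteq (\mathcal{P}_\kappa(\nu))^V$, directed under $\subseteq$, such that $|Y_\nu| = \theta$ in $W$ and $\bigcup Y_\nu = \nu$. Here $(\mathcal{P}_\kappa(\nu))^V$ is the set of all $x \in V$ with $x \subseteq \nu$ and $|x|^V < \kappa$. Moreover, if $\theta = \omega$, then $Y_\nu$ can be chosen so that in addition $(Y_\nu, \subseteq)$ is isomorphic, in $W$, to $\omega$ with its usual order. -/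

import Mathlib

namespace ModelST

/-! Throughout, a pair `(M, E)` with `E : M → M → Prop` is a structure for the language of set
theory, and `E x y` is read as "x is an element of y". Every notion below is the usual one,
interpreted inside the structure `(M, E)`. -/

/-- The relation symbols of the language of set theory: a single one, of arity two. -/
inductive setRel : ℕ → Type
  | mem : setRel 2

/-- The first-order language of set theory: one binary relation symbol. -/
def setLanguage : FirstOrder.Language.{0, 0} := ⟨fun _ => Empty, setRel⟩

/-- `(M, E)` as a first-order structure. -/
@[reducible]
def setStructure {M : Type*} (E : M → M → Prop) : setLanguage.Structure M where
  funMap := fun f => Empty.elim f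
  RelMap := fun r => match r with
    | setRel.mem => fun v => E (v 0) (v 1)

/-- `D` is a class of `(M, E)`: first-order definable with parameters from `M`. -/
def DefinableClass {M : Type*} (E : M → M → Prop) (D : M → Prop) : Prop :=
  @Set.Definable M Set.univ setLanguage (setStructure E) (Fin 1) {v | D (v 0)}

/-- `R` is a class relation of `(M, E)`: first-order definable with parameters from `M`. -/
def DefinableRel {M : Type*} (E : M → M → Prop) (R : M → M → Prop) : Prop :=
  @Set.Definable M Set.univ setLanguage (setStructure E) (Fin 2) {v | R (v 0) (v 1)}

section Notions

variable {M : Type*} (E : M → M → Prop)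

/-- `x ⊆ y`. -/
def Sub (x y : M) : Prop := ∀ z, E z x → E z y

/-- `x` is the empty set. -/
def IsEmptySet (x : M) : Prop := ∀ z, ¬ E z x

/-- `z = {a, b}`. -/
def IsUPair (z a b : M) : Prop := ∀ w, E w z ↔ w = a ∨ w = b

/-- `p = (a, b) = {{a}, {a, b}}`. -/
def IsOPair (p a b : M) : Prop := ∀ z, E z p ↔ IsUPair E z a a ∨ IsUPair E z a b

/-- `s = x ∪ {x}`. -/
def IsSuccSet (s x : M) : Prop := ∀ z, E z s ↔ E z x ∨ z = x

/-- `u = ⋃ x`. -/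
def IsUnionOf (u x : M) : Prop := ∀ z, E z u ↔ ∃ y, E y x ∧ E z y

/-- `(a, b) ∈ f`; for a function `f` this says `f(a) = b`. -/
def Maps (f a b : M) : Prop := ∃ p, IsOPair E p a b ∧ E p f

/-- `f` is a function from `a` to `b`. -/
def IsFunc (f a b : M) : Prop :=
  (∀ p, E p f → ∃ x y, E x a ∧ E y b ∧ IsOPair E p x y) ∧
    ∀ x, E x a → ∃! y, Maps E f x y

/-- `f` is a bijection from `a` onto `b`. -/
def IsBij (f a b : M) : Prop :=
  IsFunc E f a b ∧
    (∀ x x' y, Maps E f x y → Maps E f x' y → x = x') ∧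
    ∀ y, E y b → ∃ x, E x a ∧ Maps E f x y

/-- `(M, E)` is a model of `ZFC`. -/
structure IsModelZFC : Prop where
  extensionality : ∀ x y, (∀ z, E z x ↔ E z y) → x = y
  foundation : ∀ x, (∃ y, E y x) → ∃ y, E y x ∧ ∀ z, E z y → ¬ E z x
  pairing : ∀ a b, ∃ z, IsUPair E z a b
  union : ∀ x, ∃ u, IsUnionOf E u x
  powerset : ∀ x, ∃ y, ∀ z, E z y ↔ Sub E z x
  infinity : ∃ x, (∃ e, E e x ∧ IsEmptySet E e) ∧ ∀ y, E y x → ∃ s, E s x ∧ IsSuccSet E s y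
  separation : ∀ D : M → Prop, DefinableClass E D → ∀ a, ∃ b, ∀ x, E x b ↔ E x a ∧ D x
  replacement : ∀ R : M → M → Prop, DefinableRel E R → ∀ a,
    (∀ x, E x a → ∀ y y', R x y → R x y' → y = y') →
      ∃ b, ∀ y, E y b ↔ ∃ x, E x a ∧ R x y
  choice : ∀ a, (∀ x, E x a → ∃ y, E y x) →
    ∃ f u, IsFunc E f a u ∧ ∀ x y, E x a → Maps E f x y → E y x

/-- `x` is a transitive set. -/
def IsTrans (x : M) : Prop := ∀ y, E y x → Sub E y x

/-- `x` is an ordinal (von Neumann): a transitive set of transitive sets. -/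
def IsOrd (x : M) : Prop := IsTrans E x ∧ ∀ y, E y x → IsTrans E y

/-- `a ≤ b`, for ordinals `a` and `b`. -/
def Le (a b : M) : Prop := E a b ∨ a = b

/-- `x` is a nonzero limit ordinal. -/
def IsLimitOrd (x : M) : Prop :=
  IsOrd E x ∧ (∃ y, E y x) ∧ ∀ y, E y x → ∃ z, E z x ∧ E y z

/-- `x = ω`. -/
def IsOmega (x : M) : Prop := IsLimitOrd E x ∧ ∀ y, E y x → ¬ IsLimitOrd E y

/-- `c` is a cardinal: an ordinal that is not equinumerous with a smaller ordinal. -/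
def IsCard (c : M) : Prop := IsOrd E c ∧ ∀ a, E a c → ¬ ∃ f, IsBij E f a c

/-- `|x| = c`. -/
def HasCard (x c : M) : Prop := IsCard E c ∧ ∃ f, IsBij E f c x

/-- There is a function from `t` to `a` whose range is cofinal in `a`. -/
def HasCofinalMap (t a : M) : Prop :=
  ∃ f, IsFunc E f t a ∧ ∀ b, E b a → ∃ x y, E x t ∧ Maps E f x y ∧ Le E b y

/-- `cf(a) = t`: `t` is the least ordinal from which there is a cofinal map to `a`. -/
def HasCof (a t : M) : Prop :=
  IsOrd E t ∧ HasCofinalMap E t a ∧ ∀ s, E s t → ¬ HasCofinalMap E s a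

/-- `c` is a regular (infinite) cardinal. -/
def IsRegularCard (c : M) : Prop := IsCard E c ∧ IsLimitOrd E c ∧ HasCof E c c

/-- `d = c⁺`: `d` is the least cardinal above `c`. -/
def IsSuccCard (d c : M) : Prop :=
  IsCard E d ∧ E c d ∧ ∀ e, IsCard E e → E c e → Le E d e

/-- `d = c^{+a}`, by recursion: there is a function `f` on `a + 1` with `f(0) = c`,
`f(b + 1) = f(b)⁺`, `f(b) = sup_{g < b} f(g)` for limit `b`, and `f(a) = d`. -/
def IsCardShift (c a d : M) : Prop :=
  IsOrd E a ∧ ∃ s u f, IsSuccSet E s a ∧ IsFunc E f s u ∧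
    (∀ b, IsEmptySet E b → Maps E f b c) ∧
    (∀ b b' x y, E b a → IsSuccSet E b' b → Maps E f b x → Maps E f b' y →
      IsSuccCard E y x) ∧
    (∀ b y, E b s → IsLimitOrd E b → Maps E f b y →
      ∀ z, E z y ↔ ∃ g x, E g b ∧ Maps E f g x ∧ E z x) ∧
    Maps E f a d

/-- `x ∈ P_k(n)`: `x` is a subset of `n` of cardinality less than `k`. -/
def InPk (k n x : M) : Prop := Sub E x n ∧ ∃ c, E c k ∧ HasCard E x c

/-- The family `Y` is directed under inclusion. -/
def IsDirectedFamily (Y : M) : Prop :=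
  (∃ a, E a Y) ∧ ∀ a b, E a Y → E b Y → ∃ c, E c Y ∧ Sub E a c ∧ Sub E b c

/-- `(Y, ⊆)` is isomorphic to the ordinal `t` with its natural order. -/
def IsoToOrdinal (Y t : M) : Prop :=
  ∃ g, IsBij E g t Y ∧
    ∀ m n x y, Maps E g m x → Maps E g n y → (Le E m n ↔ Sub E x y)

/-- The substructure of `(M, E)` with universe `V`. -/
def restr (V : Set M) : V → V → Prop := fun x y => E x.1 y.1

/-- `V` is an inner model of `(M, E)`: a transitive class that contains all ordinals and
is a model of `ZFC`. -/
structure IsInnerModel (V : Set M) : Prop where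
  transitive : ∀ x y, x ∈ V → E y x → y ∈ V
  ordinals : ∀ a, IsOrd E a → a ∈ V
  zfc : IsModelZFC (restr E V)

end Notions

end ModelST

/-! Work in `W`. The heart is a covering statement: every ordinal `ν < λ` is contained in the union
of at most `θ` members of `q = (P_κ(λ))^V`. It is proved by induction on `ν`.

If `ν < κ`, then `ν` itself belongs to `q`. If `ν` is not a cardinal of `V`, a bijection in `V` from
a smaller ordinal carries a covering of that ordinal to one of `ν`, since images under functions of
`V` of `V`-small sets are `V`-small. If `ν ≥ κ` is a cardinal of `V`, then `ν` has a cofinal map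
from `θ` in `W`: by hypothesis when `ν` is regular in `V`; otherwise `ν = κ^{+c}` with `c < θ⁺` a
limit, and `|c| ≤ θ` already gives such a map in `V`. So `ν` is a union of `θ` many smaller
ordinals; choosing a covering of each in `W` and using `θ · θ = θ` covers `ν`. This is
`IsInnerModel.coveredBy`, resting on `IsCardShift.regular_or_cofinalFrom` and
`CoveredBy.of_cofinalFrom`.

For a cardinal `ν` of `V` in `[κ, λ)`, the covering is intersected with `ν` and closed under finite
unions. The closure stays inside `(P_κ(ν))^V`, which is union-closed, and has size at most `θ`;
including the singletons `{a}`, `a < θ`, makes the size exactly `θ`, which is a cardinal of `W`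
because it is the cofinality of `κ` there. If `θ = ω`, the unions of initial parts of an enumeration
form a chain instead; it cannot stabilize, because `ν` is not in `(P_κ(ν))^V`, so its order type is
`ω` (`CoveredBy.exists_directed`).

The models are arbitrary structures, so cardinal arithmetic is developed internally, from the
axioms. The inequality `|P| ≤ r` is expressed by `Covers`, a partial surjection from `r`: it needs
no case distinction for empty `P` and passes easily to images and unions. The class `V` is used in
`W` only through sets such as `q`, so no instance of replacement in `W` mentions `V`. -/

open FirstOrder
namespace ModelST

/-! ### First-order definability, established by instance search -/

section Definability

variable {M : Type*} (E : M → M → Prop)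

/-- `t` is a variable or a parameter. -/
class IsTerm {M : Type*} (t : (ℕ → M) → M) : Prop where
  out : (∃ k, t = fun v => v k) ∨ ∃ c, t = fun _ => c

instance IsTerm.var (k : ℕ) : IsTerm (fun v : ℕ → M => v k) := ⟨Or.inl ⟨k, rfl⟩⟩
instance IsTerm.param (c : M) : IsTerm (fun _ : ℕ → M => c) := ⟨Or.inr ⟨c, rfl⟩⟩

/-- Passing under a quantifier shifts the valuation; terms stay terms under such reindexing. -/
instance (priority := low) IsTerm.comp (f : ℕ → ℕ) (t : (ℕ → M) → M) [h : IsTerm t] :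
    IsTerm fun w => t (fun n => w (f n)) := by
  rcases h.out with ⟨k, rfl⟩ | ⟨c, rfl⟩ <;> infer_instance

/-- `P` is first-order definable with parameters, as a predicate of valuations. -/
class Dfn (P : (ℕ → M) → Prop) : Prop where
  out : @Set.Definable M Set.univ setLanguage (setStructure E) ℕ {v | P v}

theorem IsTerm.exists_term (t : (ℕ → M) → M) [h : IsTerm t] :
    letI := setStructure E
    ∃ s : setLanguage[[(Set.univ : Set M)]].Term ℕ, ∀ v, s.realize v = t v := by
  let _ := setStructure E
  rcases h.out with ⟨k, rfl⟩ | ⟨c, rfl⟩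
  · exact ⟨Language.Term.var k, fun v => rfl⟩
  · exact ⟨Language.Constants.term (setLanguage.con (⟨c, trivial⟩ : (Set.univ : Set M))), fun v => by
      simp⟩

instance Dfn.mem (t s : (ℕ → M) → M) [IsTerm t] [IsTerm s] : Dfn E fun v => E (t v) (s v) := by
  let _ := setStructure E
  obtain ⟨t', ht⟩ := IsTerm.exists_term E t
  obtain ⟨s', hs⟩ := IsTerm.exists_term E s
  let r : setLanguage.Relations 2 := setRel.mem
  refine ⟨⟨Language.Relations.formula₂
    ((setLanguage.lhomWithConstants (Set.univ : Set M)).onRelation r) t' s', ?_⟩⟩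
  ext v
  rw [Set.mem_ofPred_eq, Set.mem_ofPred_eq, Language.Formula.realize_rel₂, ht, hs,
    Language.LHom.map_onRelation]
  rfl

instance Dfn.eq (t s : (ℕ → M) → M) [IsTerm t] [IsTerm s] : Dfn E fun v => t v = s v := by
  let _ := setStructure E
  obtain ⟨t', ht⟩ := IsTerm.exists_term E t
  obtain ⟨s', hs⟩ := IsTerm.exists_term E s
  refine ⟨⟨Language.Term.equal t' s', ?_⟩⟩
  ext v
  simp [ht, hs]

instance Dfn.not (P : (ℕ → M) → Prop) [h : Dfn E P] : Dfn E fun v => ¬ P v :=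
  ⟨@Set.Definable.compl _ _ _ (setStructure E) _ _ h.out⟩

instance Dfn.and (P Q : (ℕ → M) → Prop) [h : Dfn E P] [h' : Dfn E Q] :
    Dfn E fun v => P v ∧ Q v :=
  ⟨@Set.Definable.inter _ _ _ (setStructure E) _ _ _ h.out h'.out⟩

instance Dfn.or (P Q : (ℕ → M) → Prop) [h : Dfn E P] [h' : Dfn E Q] :
    Dfn E fun v => P v ∨ Q v :=
  ⟨@Set.Definable.union _ _ _ (setStructure E) _ _ _ h.out h'.out⟩

instance Dfn.imp (P Q : (ℕ → M) → Prop) [Dfn E P] [Dfn E Q] : Dfn E fun v => P v → Q v := by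
  have : (fun v => P v → Q v) = fun v => ¬ P v ∨ Q v := by
    funext v; exact propext imp_iff_not_or
  rw [this]; infer_instance

instance Dfn.iff (P Q : (ℕ → M) → Prop) [Dfn E P] [Dfn E Q] : Dfn E fun v => P v ↔ Q v := by
  have : (fun v => P v ↔ Q v) = fun v => (P v → Q v) ∧ (Q v → P v) := by
    funext v; exact propext iff_iff_implies_and_implies
  rw [this]; infer_instance

instance Dfn.ex (P : (ℕ → M) → M → Prop) [h : Dfn E fun w => P (fun n => w (n + 1)) (w 0)] :
    Dfn E fun v => ∃ x, P v x := by
  let _ := setStructure E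
  obtain ⟨φ, hφ⟩ := h.out
  -- De Bruijn convention: variable `0` of `φ` becomes the bound variable, and variable `n + 1`
  -- becomes the free variable `n`.
  let ψ : setLanguage[[(Set.univ : Set M)]].BoundedFormula ℕ (1 + 0) :=
    Language.BoundedFormula.relabel
      (fun n : ℕ => Nat.casesOn n (Sum.inr 0) Sum.inl : ℕ → ℕ ⊕ Fin 1) φ
  have hψ (v : ℕ → M) (xs : Fin 1 → M) :
      Language.BoundedFormula.Realize ψ v xs ↔ P v (xs 0) := by
    refine Language.BoundedFormula.realize_relabel.trans ?_
    refine Iff.trans ?_ (Set.ext_iff.mp hφ (fun n => Nat.casesOn n (xs 0) v)).symm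
    refine iff_of_eq (congrArg₂ (fun a b => Language.BoundedFormula.Realize φ a b) ?_ ?_)
    · funext n; cases n <;> rfl
    · exact Subsingleton.elim _ _
  refine ⟨⟨Language.BoundedFormula.ex (n := 0) ψ, ?_⟩⟩
  ext v
  refine Iff.trans ?_ Language.BoundedFormula.realize_ex.symm
  exact exists_congr fun x => (hψ v (Fin.snoc default x)).symm

instance Dfn.all (P : (ℕ → M) → M → Prop) [h : Dfn E fun w => P (fun n => w (n + 1)) (w 0)] :
    Dfn E fun v => ∀ x, P v x := by
  have : (fun v => ∀ x, P v x) = fun v => ¬ ∃ x, ¬ P v x := by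
    funext v; simp
  rw [this]; infer_instance

/-- In `∃ x, P x ∧ ∀ y, P y → y = x` the second occurrence of `P` lies under two binders and skips
the outer one; hence the shift by two in the second hypothesis. -/
instance Dfn.exUnique (P : (ℕ → M) → M → Prop)
    [h : Dfn E fun w => P (fun n => w (n + 1)) (w 0)]
    [h : Dfn E fun w => P (fun n => w (n + 2)) (w 0)] :
    Dfn E fun v => ∃! x, P v x := by
  unfold ExistsUnique; infer_instance

instance Dfn.Sub (t s : (ℕ → M) → M) [IsTerm t] [IsTerm s] : Dfn E fun v => Sub E (t v) (s v) := by
  unfold ModelST.Sub; infer_instance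

instance Dfn.IsEmptySet (t : (ℕ → M) → M) [IsTerm t] :
    Dfn E fun v => IsEmptySet E (t v) := by
  unfold ModelST.IsEmptySet; infer_instance

instance Dfn.IsUPair (t s r : (ℕ → M) → M) [IsTerm t] [IsTerm s] [IsTerm r] :
    Dfn E fun v => IsUPair E (t v) (s v) (r v) := by
  unfold ModelST.IsUPair; infer_instance

instance Dfn.IsOPair (t s r : (ℕ → M) → M) [IsTerm t] [IsTerm s] [IsTerm r] :
    Dfn E fun v => IsOPair E (t v) (s v) (r v) := by
  unfold ModelST.IsOPair; infer_instance

instance Dfn.Maps (t s r : (ℕ → M) → M) [IsTerm t] [IsTerm s] [IsTerm r] :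
    Dfn E fun v => Maps E (t v) (s v) (r v) := by
  unfold ModelST.Maps; infer_instance

instance Dfn.IsFunc (t s r : (ℕ → M) → M) [IsTerm t] [IsTerm s] [IsTerm r] :
    Dfn E fun v => IsFunc E (t v) (s v) (r v) := by
  unfold ModelST.IsFunc; infer_instance

instance Dfn.IsBij (t s r : (ℕ → M) → M) [IsTerm t] [IsTerm s] [IsTerm r] :
    Dfn E fun v => IsBij E (t v) (s v) (r v) := by
  unfold ModelST.IsBij; infer_instance

instance Dfn.IsTrans (t : (ℕ → M) → M) [IsTerm t] :
    Dfn E fun v => IsTrans E (t v) := by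
  unfold ModelST.IsTrans; infer_instance

instance Dfn.IsOrd (t : (ℕ → M) → M) [IsTerm t] :
    Dfn E fun v => IsOrd E (t v) := by
  unfold ModelST.IsOrd; infer_instance

instance Dfn.Le (t s : (ℕ → M) → M) [IsTerm t] [IsTerm s] :
    Dfn E fun v => Le E (t v) (s v) := by
  unfold ModelST.Le; infer_instance

instance Dfn.IsLimitOrd (t : (ℕ → M) → M) [IsTerm t] :
    Dfn E fun v => IsLimitOrd E (t v) := by
  unfold ModelST.IsLimitOrd; infer_instance

abbrev Dfn₁ (P : M → Prop) : Prop := Dfn E fun v => P (v 0)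
abbrev Dfn₂ (R : M → M → Prop) : Prop := Dfn E fun v => R (v 0) (v 1)
variable {E}

theorem Dfn.comp (f : ℕ → ℕ) {P : (ℕ → M) → Prop} (h : Dfn E P) :
    Dfn E fun v => P fun n => v (f n) :=
  ⟨@Set.Definable.preimage_comp _ _ _ (setStructure E) _ _ f _ h.out⟩

theorem Dfn₂.definableRel {R : M → M → Prop} (h : Dfn₂ E R) : DefinableRel E R := by
  let _ := setStructure E
  exact Set.Definable.preimage_comp (fun n : ℕ => if n = 0 then 0 else 1) h.out

theorem Dfn₁.definableClass {P : M → Prop} (h : Dfn₁ E P) : DefinableClass E P := by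
  let _ := setStructure E
  exact Set.Definable.preimage_comp (fun _ : ℕ => 0) h.out

end Definability

section Definability

variable {M : Type*} {E : M → M → Prop}

/-- Writing `P (t v)` as `∃ x, x = t v ∧ P x` reduces substitution to quantification. This lets an
abstract definable predicate occur inside larger formulas. -/
theorem Dfn₁.subst {P : M → Prop} (h : Dfn₁ E P) (t : (ℕ → M) → M) [IsTerm t] :
    Dfn E fun v => P (t v) := by
  have h' : Dfn E fun w : ℕ → M => P (w 0) := h
  have : (fun v => P (t v)) = fun v => ∃ x, x = t v ∧ P x := by
    funext v; simp
  rw [this]; infer_instance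

theorem Dfn₂.subst {R : M → M → Prop} (h : Dfn₂ E R) (t s : (ℕ → M) → M) [IsTerm t] [IsTerm s] :
    Dfn E fun v => R (t v) (s v) := by
  have h' : Dfn E fun w : ℕ → M => R (w 1) (w 0) := h.comp fun n => if n = 0 then 1 else 0
  have : (fun v => R (t v) (s v)) = fun v => ∃ x, ∃ y, x = t v ∧ y = s v ∧ R x y := by
    funext v; simp
  rw [this]; infer_instance

end Definability

/-! ### Elementary set theory inside a model: pairs, products, functions -/

section Basic

variable {M : Type*} {E : M → M → Prop} (hM : IsModelZFC E)
include hM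

theorem IsModelZFC.ext {x y : M} (h : ∀ z, E z x ↔ E z y) : x = y := hM.extensionality x y h

theorem IsModelZFC.sep (P : M → Prop) [h : Dfn₁ E P] (a : M) :
    ∃ b, ∀ x, E x b ↔ E x a ∧ P x :=
  hM.separation P h.definableClass a

theorem IsModelZFC.repl (R : M → M → Prop) [h : Dfn₂ E R] (a : M)
    (hR : ∀ x, E x a → ∀ y y', R x y → R x y' → y = y') :
    ∃ b, ∀ y, E y b ↔ ∃ x, E x a ∧ R x y :=
  hM.replacement R h.definableRel a hR

theorem IsModelZFC.exists_opair (a b : M) : ∃ p, IsOPair E p a b := by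
  obtain ⟨u, hu⟩ := hM.pairing a a
  obtain ⟨v, hv⟩ := hM.pairing a b
  obtain ⟨p, hp⟩ := hM.pairing u v
  refine ⟨p, fun z => (hp z).trans (or_congr ⟨?_, fun h => ?_⟩ ⟨?_, fun h => ?_⟩)⟩
  · rintro rfl; exact hu
  · exact hM.ext fun w => (h w).trans (hu w).symm
  · rintro rfl; exact hv
  · exact hM.ext fun w => (h w).trans (hv w).symm

theorem IsModelZFC.opair_unique {p q a b : M} (hp : IsOPair E p a b) (hq : IsOPair E q a b) :
    p = q :=
  hM.ext fun z => (hp z).trans (hq z).symm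

theorem IsModelZFC.opair_inj {p a b c d : M} (hp : IsOPair E p a b) (hq : IsOPair E p c d) :
    a = c ∧ b = d := by
  obtain ⟨u, hu⟩ := hM.pairing a a
  obtain ⟨v, hv⟩ := hM.pairing a b
  obtain ⟨u', hu'⟩ := hM.pairing c c
  obtain ⟨v', hv'⟩ := hM.pairing c d
  have h1 := (hq u).1 ((hp u).2 (Or.inl hu))
  have h2 := (hq v).1 ((hp v).2 (Or.inr hv))
  have h3 := (hp u').1 ((hq u').2 (Or.inl hu'))
  have h4 := (hp v').1 ((hq v').2 (Or.inr hv'))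
  have hac : a = c := by
    have : E c u := by rcases h1 with h | h <;> simp [h c]
    simpa [eq_comm] using (hu c).1 this
  subst hac
  refine ⟨rfl, ?_⟩
  have hb : E b v := by simp [hv b]
  have hd : E d v' := by simp [hv' d]
  rcases h2 with h | h
  · have hba : b = a := by simpa using (h b).1 hb
    subst hba
    rcases h4 with h' | h'
    · simpa [eq_comm] using (h' d).1 hd
    · simpa [eq_comm] using (h' d).1 hd
  · rcases (h b).1 hb with hba | hbd
    · subst hba
      rcases h4 with h' | h'
      · simpa [eq_comm] using (h' d).1 hd
      · simpa [eq_comm] using (h' d).1 hd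
    · exact hbd

theorem IsModelZFC.exists_union₂ (a b : M) : ∃ u, ∀ z, E z u ↔ E z a ∨ E z b := by
  obtain ⟨p, hp⟩ := hM.pairing a b
  obtain ⟨u, hu⟩ := hM.union p
  refine ⟨u, fun z => (hu z).trans ⟨?_, ?_⟩⟩
  · rintro ⟨y, hy, hz⟩
    rcases (hp y).1 hy with rfl | rfl
    · exact Or.inl hz
    · exact Or.inr hz
  · rintro (h | h)
    · exact ⟨a, (hp a).2 (Or.inl rfl), h⟩
    · exact ⟨b, (hp b).2 (Or.inr rfl), h⟩

theorem IsModelZFC.exists_singleton (a : M) : ∃ u, ∀ z, E z u ↔ z = a := by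
  obtain ⟨p, hp⟩ := hM.pairing a a
  exact ⟨p, fun z => (hp z).trans (or_self_iff)⟩

theorem IsModelZFC.exists_succ (a : M) : ∃ s, IsSuccSet E s a := by
  obtain ⟨p, hp⟩ := hM.exists_singleton a
  obtain ⟨u, hu⟩ := hM.exists_union₂ a p
  exact ⟨u, fun z => by rw [hu, hp]⟩

theorem IsModelZFC.exists_empty : ∃ e, IsEmptySet E e :=
  let ⟨_, ⟨e, _, he⟩, _⟩ := hM.infinity
  ⟨e, he⟩

/-- The cartesian product of two sets. -/
theorem IsModelZFC.exists_prod (a b : M) :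
    ∃ c, ∀ p, E p c ↔ ∃ x y, E x a ∧ E y b ∧ IsOPair E p x y := by
  obtain ⟨u, hu⟩ := hM.exists_union₂ a b
  obtain ⟨v, hv⟩ := hM.powerset u
  obtain ⟨w, hw⟩ := hM.powerset v
  obtain ⟨c, hc⟩ := hM.sep (fun p => ∃ x y, E x a ∧ E y b ∧ IsOPair E p x y) w
  refine ⟨c, fun p => (hc p).trans (and_iff_right_of_imp ?_)⟩
  rintro ⟨x, y, hx, hy, hp⟩
  refine (hw p).2 fun z hz => (hv z).2 fun t ht => (hu t).2 ?_
  rcases (hp z).1 hz with h | h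
  · rcases (h t).1 ht with rfl | rfl <;> exact Or.inl hx
  · rcases (h t).1 ht with rfl | rfl
    · exact Or.inl hx
    · exact Or.inr hy

theorem IsModelZFC.exists_rel (R : M → M → Prop) [h : Dfn₂ E R] (a b : M) :
    ∃ f, (∀ p, E p f → ∃ x y, E x a ∧ E y b ∧ IsOPair E p x y) ∧
      ∀ x y, Maps E f x y ↔ E x a ∧ E y b ∧ R x y := by
  -- Placed in the context as a local instance, so that formulas mentioning `R` at arbitrary terms
  -- are found definable.
  have := fun t s [IsTerm t] [IsTerm s] => h.subst t s
  obtain ⟨c, hc⟩ := hM.exists_prod a b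
  obtain ⟨f, hf⟩ := hM.sep (fun p => ∃ x y, IsOPair E p x y ∧ R x y) c
  refine ⟨f, fun p hp => (hc p).1 ((hf p).1 hp).1, fun x y => ⟨?_, ?_⟩⟩
  · rintro ⟨p, hp, hpf⟩
    obtain ⟨hpc, x', y', hp', hR⟩ := (hf p).1 hpf
    obtain ⟨x'', y'', hx, hy, hp''⟩ := (hc p).1 hpc
    obtain ⟨rfl, rfl⟩ := hM.opair_inj hp hp'
    obtain ⟨rfl, rfl⟩ := hM.opair_inj hp hp''
    exact ⟨hx, hy, hR⟩
  · rintro ⟨hx, hy, hR⟩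
    obtain ⟨p, hp⟩ := hM.exists_opair x y
    exact ⟨p, hp, (hf p).2 ⟨(hc p).2 ⟨x, y, hx, hy, hp⟩, x, y, hp, hR⟩⟩

/-- Replacement supplies the codomain, so neither a bound on the values nor totality of `R` is
required. -/
theorem IsModelZFC.exists_graph (R : M → M → Prop) [h : Dfn₂ E R] (a : M)
    (hR : ∀ x, E x a → ∀ y y', R x y → R x y' → y = y') :
    ∃ f, ∀ x y, Maps E f x y ↔ E x a ∧ R x y := by
  obtain ⟨b, hb⟩ := hM.repl R a hR
  obtain ⟨f, -, hf⟩ := hM.exists_rel R a b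
  exact ⟨f, fun x y => (hf x y).trans
    ⟨fun h => ⟨h.1, h.2.2⟩, fun h => ⟨h.1, (hb y).2 ⟨x, h⟩, h.2⟩⟩⟩

theorem IsModelZFC.exists_func (R : M → M → Prop) [h : Dfn₂ E R] (a b : M)
    (ht : ∀ x, E x a → ∃ y, E y b ∧ R x y)
    (hR : ∀ x y y', E x a → E y b → E y' b → R x y → R x y' → y = y') :
    ∃ f, IsFunc E f a b ∧ ∀ x y, Maps E f x y ↔ E x a ∧ E y b ∧ R x y := by
  obtain ⟨f, hf, hf'⟩ := hM.exists_rel R a b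
  refine ⟨f, ⟨hf, fun x hx => ?_⟩, hf'⟩
  obtain ⟨y, hy, hxy⟩ := ht x hx
  refine ⟨y, (hf' x y).2 ⟨hx, hy, hxy⟩, fun y' h => ?_⟩
  obtain ⟨-, hy', h⟩ := (hf' x y').1 h
  exact hR x y' y hx hy' hy h hxy

theorem IsModelZFC.exists_bij (R : M → M → Prop) [h : Dfn₂ E R] (a b : M)
    (ht : ∀ x, E x a → ∃ y, E y b ∧ R x y)
    (hR : ∀ x y y', E x a → E y b → E y' b → R x y → R x y' → y = y')
    (hinj : ∀ x x' y, E x a → E x' a → E y b → R x y → R x' y → x = x')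
    (hsurj : ∀ y, E y b → ∃ x, E x a ∧ R x y) :
    ∃ f, IsBij E f a b ∧ ∀ x y, Maps E f x y ↔ E x a ∧ E y b ∧ R x y := by
  obtain ⟨f, hf, hf'⟩ := hM.exists_func R a b ht hR
  refine ⟨f, ⟨hf, fun x x' y h h' => ?_, fun y hy => ?_⟩, hf'⟩
  · rw [hf'] at h h'
    exact hinj x x' y h.1 h'.1 h.2.1 h.2.2 h'.2.2
  · obtain ⟨x, hx, hxy⟩ := hsurj y hy
    exact ⟨x, hx, (hf' x y).2 ⟨hx, hy, hxy⟩⟩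

theorem IsFunc.maps_mem {f a b x y : M} (hf : IsFunc E f a b) (h : Maps E f x y) :
    E x a ∧ E y b := by
  obtain ⟨p, hp, hpf⟩ := h
  obtain ⟨x', y', hx, hy, hp'⟩ := hf.1 p hpf
  obtain ⟨rfl, rfl⟩ := hM.opair_inj hp hp'
  exact ⟨hx, hy⟩

theorem IsFunc.maps_unique {f a b x y y' : M} (hf : IsFunc E f a b) (h : Maps E f x y)
    (h' : Maps E f x y') : y = y' :=
  (hf.2 x (hf.maps_mem hM h).1).unique h h'

theorem IsFunc.exists_maps {f a b x : M} (hf : IsFunc E f a b) (hx : E x a) :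
    ∃ y, E y b ∧ Maps E f x y :=
  let ⟨y, hy, _⟩ := hf.2 x hx
  ⟨y, (hf.maps_mem hM hy).2, hy⟩

theorem IsBij.trans {f g a b c : M} (hf : IsBij E f a b) (hg : IsBij E g b c) :
    ∃ h, IsBij E h a c := by
  obtain ⟨h, hh, -⟩ := hM.exists_bij (fun x z => ∃ y, Maps E f x y ∧ Maps E g y z) a c
    (fun x hx => by
      obtain ⟨y, hy, hxy⟩ := hf.1.exists_maps hM hx
      obtain ⟨z, hz, hyz⟩ := hg.1.exists_maps hM hy
      exact ⟨z, hz, y, hxy, hyz⟩)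
    (by
      rintro x z z' _ _ _ ⟨y, h1, h2⟩ ⟨y', h3, h4⟩
      obtain rfl := hf.1.maps_unique hM h1 h3
      exact hg.1.maps_unique hM h2 h4)
    (by
      rintro x x' z _ _ _ ⟨y, h1, h2⟩ ⟨y', h3, h4⟩
      obtain rfl := hg.2.1 _ _ _ h2 h4
      exact hf.2.1 _ _ _ h1 h3)
    (by
      intro z hz
      obtain ⟨y, hy, hyz⟩ := hg.2.2 z hz
      obtain ⟨x, hx, hxy⟩ := hf.2.2 y hy
      exact ⟨x, hx, y, hxy, hyz⟩)
  exact ⟨h, hh⟩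

theorem IsModelZFC.irrefl (x : M) : ¬ E x x := by
  intro h
  obtain ⟨u, hu⟩ := hM.exists_singleton x
  obtain ⟨y, hy, hy'⟩ := hM.foundation u ⟨x, (hu x).2 rfl⟩
  rw [hu] at hy
  subst hy
  exact hy' y h ((hu y).2 rfl)

end Basic

/-! ### Ordinals and induction over definable predicates -/

section Ordinals

variable {M : Type*} {E : M → M → Prop} (hM : IsModelZFC E)

theorem IsOrd.mem {a x : M} (ha : IsOrd E a) (hx : E x a) : IsOrd E x :=
  ⟨ha.2 x hx, fun y hy => ha.2 y (ha.1 x hx y hy)⟩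

theorem IsOrd.mem_trans {a x y : M} (ha : IsOrd E a) (hx : E x a) (hy : E y x) : E y a :=
  ha.1 x hx y hy

theorem IsOrd.succ {a s : M} (ha : IsOrd E a) (hs : IsSuccSet E s a) : IsOrd E s := by
  refine ⟨fun y hy z hz => ?_, fun y hy => ?_⟩
  · rw [hs] at hy ⊢
    rcases hy with hy | rfl
    · exact Or.inl (ha.mem_trans hy hz)
    · exact Or.inl hz
  · rcases (hs y).1 hy with hy | rfl
    · exact ha.2 y hy
    · exact ha.1

theorem Le.sub {a b : M} (hb : IsOrd E b) (h : Le E a b) : Sub E a b := by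
  rcases h with h | rfl
  · exact hb.1 a h
  · exact fun z hz => hz

theorem Le.mem {a b x : M} (hb : IsOrd E b) (h : Le E a b) (hx : E x a) : E x b := h.sub hb x hx

theorem Le.trans {a b c : M} (hc : IsOrd E c) (h : Le E a b) (h' : Le E b c) : Le E a c := by
  rcases h with h | rfl
  · exact Or.inl (h'.mem hc h)
  · exact h'

theorem Le.refl (a : M) : Le E a a := Or.inr rfl

theorem Le.isOrd {a b : M} (hb : IsOrd E b) (h : Le E a b) : IsOrd E a := by
  rcases h with h | rfl
  · exact hb.mem h
  · exact hb

include hM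

theorem IsModelZFC.exists_least (P : M → Prop) [Dfn₁ E P] {a : M} (ha : IsOrd E a) (hP : P a) :
    ∃ b, Le E b a ∧ P b ∧ ∀ c, E c b → ¬ P c := by
  obtain ⟨s, hs⟩ := hM.sep P a
  by_cases h : ∃ y, E y s
  · obtain ⟨b, hb, hb'⟩ := hM.foundation s h
    have hb1 := (hs b).1 hb
    exact ⟨b, Or.inl hb1.1, hb1.2, fun c hc hPc =>
      hb' c hc ((hs c).2 ⟨ha.mem_trans hb1.1 hc, hPc⟩)⟩
  · exact ⟨a, Le.refl a, hP, fun c hc hPc => h ⟨c, (hs c).2 ⟨hc, hPc⟩⟩⟩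

/-- The model may be ill-founded seen from outside, so induction is available only for definable
predicates. Statements proved by induction below are therefore phrased internally. -/
theorem IsModelZFC.ord_induction (P : M → Prop) [Dfn₁ E P] {a : M} (ha : IsOrd E a)
    (h : ∀ b, Le E b a → (∀ c, E c b → P c) → P b) : P a := by
  by_contra hn
  obtain ⟨b, hb, hPb, hmin⟩ := hM.exists_least (fun x => ¬ P x) ha hn
  exact hPb (h b hb fun c hc => not_not.1 (hmin c hc))

theorem IsOrd.trichotomy {a b : M} (ha : IsOrd E a) (hb : IsOrd E b) :
    E a b ∨ a = b ∨ E b a := by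
  by_contra hn
  obtain ⟨a', ha', ⟨b₀, hb₀, hn'⟩, hmin⟩ :=
    hM.exists_least (fun a => ∃ b, IsOrd E b ∧ ¬ (E a b ∨ a = b ∨ E b a)) ha ⟨b, hb, hn⟩
  replace ha' := ha'.isOrd ha
  obtain ⟨b', hb', hn'', hmin'⟩ :=
    hM.exists_least (fun b => ¬ (E a' b ∨ a' = b ∨ E b a')) hb₀ hn'
  replace hb' := hb'.isOrd hb₀
  -- With `a'` least, and `b'` least for `a'`, all elements of either are comparable with the other
  -- ordinal, which forces the two to have the same elements.
  refine hn'' (Or.inr (Or.inl (hM.ext fun z => ⟨fun hz => ?_, fun hz => ?_⟩)))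
  · by_contra hzb
    refine hmin z hz ⟨b', hb', ?_⟩
    rintro (h | rfl | h)
    · exact hzb h
    · exact hn'' (Or.inr (Or.inr hz))
    · exact hn'' (Or.inr (Or.inr (ha'.mem_trans hz h)))
  · by_contra hza
    refine hmin' z hz ?_
    rintro (h | rfl | h)
    · exact hn'' (Or.inl (hb'.mem_trans hz h))
    · exact hn'' (Or.inl hz)
    · exact hza h

theorem IsOrd.lt_or_le {a b : M} (ha : IsOrd E a) (hb : IsOrd E b) : E a b ∨ Le E b a := by
  rcases ha.trichotomy hM hb with h | h | h
  · exact Or.inl h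
  · exact Or.inr (Or.inr h.symm)
  · exact Or.inr (Or.inl h)

theorem IsOrd.le_total {a b : M} (ha : IsOrd E a) (hb : IsOrd E b) : Le E a b ∨ Le E b a := by
  rcases ha.lt_or_le hM hb with h | h
  · exact Or.inl (Or.inl h)
  · exact Or.inr h

theorem IsOrd.not_mem_of_le {a b : M} (ha : IsOrd E a) (h : Le E b a) : ¬ E a b :=
  fun h' => hM.irrefl a (h.mem ha h')

end Ordinals

/-! ### Mostowski collapse of a definable well-order -/

section Collapse

variable {M : Type*} {E : M → M → Prop}

/-- `f` is a partial collapsing map of `(A, R)`, defined on an `R`-initial segment of `A`. -/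
def IsCollapsing (E : M → M → Prop) (A : M) (R : M → M → Prop) (f : M) : Prop :=
  (∀ b y, Maps E f b y → E b A ∧ ∀ z, E z y ↔ ∃ c, E c A ∧ R c b ∧ Maps E f c z) ∧
    ∀ b y c, Maps E f b y → E c A → R c b → ∃ z, Maps E f c z

/-- The collapsing map of `(A, R)` sends `b` to `y`. -/
def Collapses (E : M → M → Prop) (A : M) (R : M → M → Prop) (b y : M) : Prop :=
  ∃ f, IsCollapsing E A R f ∧ Maps E f b y

theorem Collapses.dfn (A : M) (R : M → M → Prop) [h : Dfn₂ E R] :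
    Dfn₂ E (Collapses E A R) := by
  have := fun t s [IsTerm t] [IsTerm s] => h.subst t s
  unfold Collapses IsCollapsing
  infer_instance

/-- `(A, R)` is a well-order in the sense of the model. -/
structure IsWellOrderOn (E : M → M → Prop) (A : M) (R : M → M → Prop) : Prop where
  wf : ∀ s, Sub E s A → (∃ x, E x s) → ∃ m, E m s ∧ ∀ z, E z s → ¬ R z m
  trans : ∀ x y z, E x A → E y A → E z A → R x y → R y z → R x z
  total : ∀ x y, E x A → E y A → x ≠ y → R x y ∨ R y x

variable (hM : IsModelZFC E) {A : M} {R : M → M → Prop}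
include hM

theorem IsWellOrderOn.induction (hR : IsWellOrderOn E A R) (P : M → Prop) [Dfn₁ E P]
    (h : ∀ b, E b A → (∀ c, E c A → R c b → P c) → P b) {b : M} (hb : E b A) : P b := by
  by_contra hn
  obtain ⟨s, hs⟩ := hM.sep (fun x => ¬ P x) A
  obtain ⟨m, hm, hmin⟩ := hR.wf s (fun z hz => ((hs z).1 hz).1) ⟨b, (hs b).2 ⟨hb, hn⟩⟩
  obtain ⟨hmA, hm'⟩ := (hs m).1 hm
  refine hm' (h m hmA fun c hc hcm => ?_)
  by_contra hPc
  exact hmin c ((hs c).2 ⟨hc, hPc⟩) hcm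

theorem IsWellOrderOn.collapsing_agree (hR : IsWellOrderOn E A R) {f f' b y y' : M}
    [Dfn₂ E R] (hf : IsCollapsing E A R f) (hf' : IsCollapsing E A R f')
    (hy : Maps E f b y) (hy' : Maps E f' b y') : y = y' := by
  refine hR.induction hM (fun b => ∀ y y', Maps E f b y → Maps E f' b y' → y = y')
    (fun b hb ih y y' hy hy' => ?_) (hf.1 b y hy).1 y y' hy hy'
  refine hM.ext fun z => ?_
  rw [(hf.1 b y hy).2, (hf'.1 b y' hy').2]
  refine exists_congr fun c => and_congr_right fun hc => and_congr_right fun hcb => ?_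
  obtain ⟨w, hw⟩ := hf.2 b y c hy hc hcb
  obtain ⟨w', hw'⟩ := hf'.2 b y' c hy' hc hcb
  have hww := ih c hc hcb w w' hw hw'
  subst hww
  refine ⟨fun hz => ?_, fun hz => ?_⟩
  · rw [ih c hc hcb z w hz hw']; exact hw'
  · rw [← ih c hc hcb w z hw hz]; exact hw

theorem IsWellOrderOn.collapses_unique (hR : IsWellOrderOn E A R) [Dfn₂ E R] {b y y' : M}
    (h : Collapses E A R b y) (h' : Collapses E A R b y') : y = y' := by
  obtain ⟨f, hf, hb⟩ := h
  obtain ⟨f', hf', hb'⟩ := h'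
  exact hR.collapsing_agree hM hf hf' hb hb'

theorem IsWellOrderOn.collapses_spec (hR : IsWellOrderOn E A R) [Dfn₂ E R] {b y : M}
    (h : Collapses E A R b y) :
    E b A ∧ ∀ z, E z y ↔ ∃ c, E c A ∧ R c b ∧ Collapses E A R c z := by
  obtain ⟨f, hf, hb⟩ := h
  refine ⟨(hf.1 b y hb).1, fun z => ((hf.1 b y hb).2 z).trans ?_⟩
  refine exists_congr fun c => and_congr_right fun hc => and_congr_right fun hcb =>
    ⟨fun hz => ⟨f, hf, hz⟩, fun hz => ?_⟩
  obtain ⟨w, hw⟩ := hf.2 b y c hb hc hcb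
  rw [hR.collapses_unique hM hz ⟨f, hf, hw⟩]
  exact hw

theorem IsWellOrderOn.collapses_total (hR : IsWellOrderOn E A R) [h : Dfn₂ E R] {b : M}
    (hb : E b A) : ∃ y, Collapses E A R b y := by
  have inst := fun t s [IsTerm t] [IsTerm s] => h.subst t s
  have hdfn := Collapses.dfn (E := E) A R
  have inst' := fun t s [IsTerm t] [IsTerm s] => hdfn.subst t s
  refine hR.induction hM (fun b => ∃ y, Collapses E A R b y) (fun b hb ih => ?_) hb
  obtain ⟨a', ha'⟩ := hM.sep (fun c => R c b) A
  obtain ⟨sb, hsb⟩ := hM.exists_singleton b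
  obtain ⟨a, ha⟩ := hM.exists_union₂ a' sb
  have hbelow : ∀ c d, E c a → E d A → R d c → R d b := by
    intro c d hc hd hdc
    rcases (ha c).1 hc with hc | hc
    · exact hR.trans d c b hd ((ha' c).1 hc).1 hb hdc ((ha' c).1 hc).2
    · rwa [(hsb c).1 hc] at hdc
  have hmem : ∀ d, E d A → R d b → E d a := fun d hd hdb => (ha d).2 (Or.inl ((ha' d).2 ⟨hd, hdb⟩))
  have haA : ∀ c, E c a → E c A := by
    intro c hc
    rcases (ha c).1 hc with hc | hc
    · exact ((ha' c).1 hc).1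
    · rwa [(hsb c).1 hc]
  -- No recursion is needed: `f` sends `c` to the set of collapses of its predecessors. Below `b`
  -- these values agree, by induction, with the collapses already known to exist.
  obtain ⟨f, hf⟩ := hM.exists_graph
    (fun c y => ∀ z, E z y ↔ ∃ d, E d A ∧ R d c ∧ Collapses E A R d z) a
    (fun c _ y y' hy hy' => hM.ext fun z => (hy z).trans (hy' z).symm)
  have hiff : ∀ c y, E c A → R c b → (Maps E f c y ↔ Collapses E A R c y) := by
    intro c y hc hcb
    rw [hf]
    refine ⟨fun h => ?_, fun h => ⟨hmem c hc hcb, (hR.collapses_spec hM h).2⟩⟩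
    obtain ⟨y', hy'⟩ := ih c hc hcb
    have : y = y' := hM.ext fun z => (h.2 z).trans ((hR.collapses_spec hM hy').2 z).symm
    rwa [this]
  have hcoll : IsCollapsing E A R f := by
    refine ⟨fun c y hy => ?_, fun c y d hy hd hdc => ?_⟩
    · obtain ⟨hc, hy⟩ := (hf c y).1 hy
      refine ⟨haA c hc, fun z => (hy z).trans ?_⟩
      exact exists_congr fun d => and_congr_right fun hd => and_congr_right fun hdc =>
        (hiff d z hd (hbelow c d hc hd hdc)).symm
    · have hdb := hbelow c d ((hf c y).1 hy).1 hd hdc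
      obtain ⟨z, hz⟩ := ih d hd hdb
      exact ⟨z, (hiff d z hd hdb).2 hz⟩
  obtain ⟨y, hy⟩ := hM.repl (Collapses E A R) a'
    fun x _ y y' h h' => hR.collapses_unique hM h h'
  refine ⟨y, f, hcoll, (hf b y).2 ⟨(ha b).2 (Or.inr ((hsb b).2 rfl)), fun z => (hy z).trans ?_⟩⟩
  exact exists_congr fun d => by rw [ha', and_assoc]

/-- Every well-order is isomorphic to an ordinal. -/
theorem IsWellOrderOn.exists_ordinal (hR : IsWellOrderOn E A R) [Dfn₂ E R] :
    ∃ T g, IsOrd E T ∧ IsBij E g T A ∧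
      ∀ m n x y, Maps E g m x → Maps E g n y → (E m n ↔ R x y) := by
  have hdfn := Collapses.dfn (E := E) A R
  have inst' := fun t s [IsTerm t] [IsTerm s] => hdfn.subst t s
  obtain ⟨T, hT⟩ := hM.repl (Collapses E A R) A fun x _ y y' h h' => hR.collapses_unique hM h h'
  have hord : IsOrd E T := by
    refine ⟨fun y hy z hz => ?_, fun y hy z hz w hw => ?_⟩
    · obtain ⟨b, hb, hby⟩ := (hT y).1 hy
      obtain ⟨c, hc, hcb, hcz⟩ := ((hR.collapses_spec hM hby).2 z).1 hz
      exact (hT z).2 ⟨c, hc, hcz⟩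
    · obtain ⟨b, hb, hby⟩ := (hT y).1 hy
      obtain ⟨c, hc, hcb, hcz⟩ := ((hR.collapses_spec hM hby).2 z).1 hz
      obtain ⟨d, hd, hdc, hdw⟩ := ((hR.collapses_spec hM hcz).2 w).1 hw
      exact ((hR.collapses_spec hM hby).2 w).2 ⟨d, hd, hR.trans d c b hd hc hb hdc hcb, hdw⟩
  have hlt : ∀ {m n x y}, Collapses E A R x m → Collapses E A R y n → R x y → E m n :=
    fun hx hy hxy => ((hR.collapses_spec hM hy).2 _).2 ⟨_, (hR.collapses_spec hM hx).1, hxy, hx⟩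
  have hinj : ∀ {m x x'}, Collapses E A R x m → Collapses E A R x' m → x = x' := by
    intro m x x' hx hx'
    by_contra hne
    rcases hR.total x x' (hR.collapses_spec hM hx).1 (hR.collapses_spec hM hx').1 hne with h | h
    · exact hM.irrefl m (hlt hx hx' h)
    · exact hM.irrefl m (hlt hx' hx h)
  obtain ⟨g, hg, hg'⟩ := hM.exists_bij (fun m x => Collapses E A R x m) T A
    (fun m hm => (hT m).1 hm) (fun _ _ _ _ _ _ h h' => hinj h h')
    (fun _ _ _ _ _ _ h h' => hR.collapses_unique hM h h')
    (fun x hx => by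
      obtain ⟨m, hm⟩ := hR.collapses_total hM hx
      exact ⟨m, (hT m).2 ⟨x, hx, hm⟩, hm⟩)
  refine ⟨T, g, hord, hg, fun m n x y hx hy => ⟨fun h => ?_, fun h => ?_⟩⟩
  · obtain ⟨hmT, hxA, hx⟩ := (hg' m x).1 hx
    obtain ⟨hnT, hyA, hy⟩ := (hg' n y).1 hy
    by_cases hxy : x = y
    · subst hxy
      rw [hR.collapses_unique hM hx hy] at h
      exact absurd h (hM.irrefl n)
    · rcases hR.total x y hxA hyA hxy with h' | h'
      · exact h'
      · exact absurd ((hord.mem hmT).mem_trans (hlt hy hx h') h) (hM.irrefl m)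
  · exact hlt ((hg' m x).1 hx).2.2 ((hg' n y).1 hy).2.2 h

end Collapse

/-! ### Cardinal inequalities through partial surjections -/

section Covering

variable {M : Type*} {E : M → M → Prop}

/-- `f` is single-valued. -/
def SingleValued (E : M → M → Prop) (f : M) : Prop :=
  ∀ x y y', Maps E f x y → Maps E f x y' → y = y'

/-- Some partial function covers the class `P` by values at elements of `r`. -/
def Covers (E : M → M → Prop) (r : M) (P : M → Prop) : Prop :=
  ∃ f, SingleValued E f ∧ ∀ z, P z → ∃ i, E i r ∧ Maps E f i z

instance Dfn.SingleValued (t : (ℕ → M) → M) [IsTerm t] :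
    Dfn E fun v => SingleValued E (t v) := by
  unfold ModelST.SingleValued; infer_instance

theorem Dfn.swap {P : (ℕ → M) → M → Prop} (h : Dfn E fun w => P (fun n => w (n + 1)) (w 0)) :
    Dfn E fun w => P (fun n => w (n + 2)) (w 0) :=
  h.comp fun n => if n = 0 then 0 else n + 1

instance Dfn.Covers (t : (ℕ → M) → M) [IsTerm t] (P : (ℕ → M) → M → Prop)
    [h : Dfn E fun w => P (fun n => w (n + 1)) (w 0)] :
    Dfn E fun v => Covers E (t v) (P v) := by
  have := h.swap
  unfold ModelST.Covers; infer_instance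

theorem Covers.mono {r : M} {P Q : M → Prop} (h : Covers E r Q) (hPQ : ∀ z, P z → Q z) :
    Covers E r P :=
  let ⟨f, hf, hf'⟩ := h
  ⟨f, hf, fun z hz => hf' z (hPQ z hz)⟩

theorem Covers.mono_left {r r' : M} {P : M → Prop} (h : Covers E r P) (hr : Sub E r r') :
    Covers E r' P :=
  let ⟨f, hf, hf'⟩ := h
  ⟨f, hf, fun z hz => let ⟨i, hi, hz⟩ := hf' z hz; ⟨i, hr i hi, hz⟩⟩

variable (hM : IsModelZFC E)
include hM

theorem Covers.image {r : M} {P Q : M → Prop} (h : Covers E r P) (R : M → M → Prop)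
    [hP : Dfn₁ E P] [hR : Dfn₂ E R]
    (hfun : ∀ x y y', P x → R x y → R x y' → y = y') (hQ : ∀ z, Q z → ∃ x, P x ∧ R x z) :
    Covers E r Q := by
  have := fun t s [IsTerm t] [IsTerm s] => hR.subst t s
  have := fun t [IsTerm t] => hP.subst t
  obtain ⟨f, hf, hf'⟩ := h
  obtain ⟨g, hg⟩ := hM.exists_graph (fun i z => ∃ x, Maps E f i x ∧ P x ∧ R x z) r (by
    rintro i - y y' ⟨x, h1, h2, h3⟩ ⟨x', h1', h2', h3'⟩
    obtain rfl := hf _ _ _ h1 h1'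
    exact hfun x y y' h2 h3 h3')
  refine ⟨g, fun i y y' h h' => ?_, fun z hz => ?_⟩
  · rw [hg] at h h'
    obtain ⟨-, x, h1, h2, h3⟩ := h
    obtain ⟨-, x', h1', h2', h3'⟩ := h'
    obtain rfl := hf _ _ _ h1 h1'
    exact hfun x y y' h2 h3 h3'
  · obtain ⟨x, hx, hxz⟩ := hQ z hz
    obtain ⟨i, hi, hix⟩ := hf' x hx
    exact ⟨i, hi, (hg i z).2 ⟨hi, x, hix, hx, hxz⟩⟩

theorem IsBij.covers {f a b : M} (hf : IsBij E f a b) : Covers E a fun z => E z b :=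
  ⟨f, fun _ _ _ h h' => hf.1.maps_unique hM h h', hf.2.2⟩

theorem IsModelZFC.covers_refl (a : M) : Covers E a fun z => E z a := by
  obtain ⟨f, hf, -⟩ := hM.exists_bij (fun x y => x = y) a a (fun x hx => ⟨x, hx, rfl⟩)
    (fun _ _ _ _ _ _ h h' => h.symm.trans h') (fun _ _ _ _ _ _ h h' => h.trans h'.symm)
    (fun y hy => ⟨y, hy, rfl⟩)
  exact hf.covers hM

/-- Keeping only the least index of each value makes the partial surjection injective. Its domain is
then a set of ordinals below `r`, whose order type is at most `r`. -/
theorem Covers.exists_bij {r x : M} (hr : IsOrd E r) (h : Covers E r fun z => E z x) :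
    ∃ c f, Le E c r ∧ IsBij E f c x := by
  obtain ⟨f, hf, hf'⟩ := h
  obtain ⟨A, hA⟩ := hM.sep
    (fun i => ∃ z, E z x ∧ Maps E f i z ∧ ∀ j, E j i → ¬ Maps E f j z) r
  have hwo : IsWellOrderOn E A E := by
    refine ⟨fun s _ hs => ?_, fun a b c _ _ hc hab hbc => ?_, fun a b ha hb hne => ?_⟩
    · obtain ⟨m, hm, hmin⟩ := hM.foundation s hs
      exact ⟨m, hm, fun z hz hzm => hmin z hzm hz⟩
    · exact (hr.mem ((hA c).1 hc).1).mem_trans hbc hab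
    · rcases (hr.mem ((hA a).1 ha).1).trichotomy hM (hr.mem ((hA b).1 hb).1) with h | h | h
      · exact Or.inl h
      · exact absurd h hne
      · exact Or.inr h
  obtain ⟨T, g, hT, hg, hgE⟩ := hwo.exists_ordinal hM
  have hTr : Le E T r := by
    rcases hr.lt_or_le hM hT with hrT | h
    · exfalso
      obtain ⟨k, hk, hgk⟩ := hg.1.exists_maps hM hrT
      have hkr := ((hA k).1 hk).1
      -- An increasing map on ordinals has no `m` with `g(m) < m`: for the least such `m`, also
      -- `g(g(m)) < g(m)`.
      obtain ⟨m, -, ⟨hmT, k', hgm, hkm⟩, hmin⟩ := hM.exists_least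
        (fun m => E m T ∧ ∃ k, Maps E g m k ∧ E k m) hr ⟨hrT, k, hgk, hkr⟩
      have hk'T := hT.mem_trans hmT hkm
      obtain ⟨l, hl, hgl⟩ := hg.1.exists_maps hM hk'T
      exact hmin k' hkm ⟨hk'T, l, hgl, (hgE k' m l k' hgl hgm).1 hkm⟩
    · exact h
  obtain ⟨f', hf'', -⟩ := hM.exists_bij (Maps E f) A x
    (fun i hi => by
      obtain ⟨-, z, hz, hiz, -⟩ := (hA i).1 hi
      exact ⟨z, hz, hiz⟩)
    (fun i y y' _ _ _ h h' => hf i y y' h h')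
    (fun i i' y hi hi' _ h h' => by
      obtain ⟨hir, z, hz, hiz, hmin⟩ := (hA i).1 hi
      obtain ⟨hir', z', hz', hiz', hmin'⟩ := (hA i').1 hi'
      obtain rfl := hf _ _ _ h hiz
      obtain rfl := hf _ _ _ h' hiz'
      rcases (hr.mem hir).trichotomy hM (hr.mem hir') with h'' | h'' | h''
      · exact absurd h (hmin' i h'')
      · exact h''
      · exact absurd h' (hmin i' h''))
    (fun y hy => by
      obtain ⟨i, hi, hiy⟩ := hf' y hy
      obtain ⟨j, hj, hjy, hmin⟩ := hM.exists_least (fun i => Maps E f i y) (hr.mem hi) hiy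
      exact ⟨j, (hA j).2 ⟨by
        rcases hj with hj | rfl
        · exact hr.mem_trans hi hj
        · exact hi, y, hy, hjy, hmin⟩, hjy⟩)
  obtain ⟨k, hk⟩ := hg.trans hM hf''
  exact ⟨T, k, hTr, hk⟩

theorem Covers.exists_hasCard {r x : M} (hr : IsOrd E r) (h : Covers E r fun z => E z x) :
    ∃ c, Le E c r ∧ HasCard E x c := by
  obtain ⟨c, f, hc, hf⟩ := h.exists_bij hM hr
  obtain ⟨d, hd, ⟨g, hg⟩, hmin⟩ := hM.exists_least (fun c => ∃ f, IsBij E f c x) (hc.isOrd hr) ⟨f, hf⟩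
  refine ⟨d, hd.trans hr hc, ⟨hd.isOrd (hc.isOrd hr), ?_⟩, g, hg⟩
  rintro a ha ⟨k, hk⟩
  exact hmin a ha (hk.trans hM hg)

theorem IsCard.not_covers {c a : M} (hc : IsCard E c) (ha : E a c) :
    ¬ Covers E a fun z => E z c := by
  intro h
  obtain ⟨d, f, hd, hf⟩ := h.exists_bij hM (hc.1.mem ha)
  refine hc.2 d ?_ ⟨f, hf⟩
  rcases hd with hd | rfl
  · exact hc.1.mem_trans ha hd
  · exact ha

/-- The axiom selects from the members of a set, so it is applied to the fibres `{f ∈ b | S i f}`,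
collected by replacement. The bound `b` is what makes each fibre a set. -/
theorem IsModelZFC.exists_choice (a b : M) (S : M → M → Prop) [hS : Dfn₂ E S]
    (h : ∀ i, E i a → ∃ f, E f b ∧ S i f) :
    ∃ g, SingleValued E g ∧ ∀ i, E i a → ∃ f, Maps E g i f ∧ S i f := by
  have := fun t s [IsTerm t] [IsTerm s] => hS.subst t s
  obtain ⟨a', ha'⟩ := hM.repl (fun i s => ∀ f, E f s ↔ E f b ∧ S i f) a
    (fun i _ y y' hy hy' => hM.ext fun z => (hy z).trans (hy' z).symm)
  obtain ⟨F, u, hF, hF'⟩ := hM.choice a' (fun s hs => by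
    obtain ⟨i, hi, his⟩ := (ha' s).1 hs
    obtain ⟨f, hf⟩ := h i hi
    exact ⟨f, (his f).2 hf⟩)
  have huniq : ∀ i y y', (∃ s, (∀ f, E f s ↔ E f b ∧ S i f) ∧ Maps E F s y) →
      (∃ s, (∀ f, E f s ↔ E f b ∧ S i f) ∧ Maps E F s y') → y = y' := by
    rintro i y y' ⟨s, hs, hsy⟩ ⟨s', hs', hsy'⟩
    obtain rfl : s = s' := hM.ext fun z => (hs z).trans (hs' z).symm
    exact hF.maps_unique hM hsy hsy'
  obtain ⟨g, hg⟩ := hM.exists_graph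
    (fun i f => ∃ s, (∀ f, E f s ↔ E f b ∧ S i f) ∧ Maps E F s f) a
    (fun i _ y y' h h' => huniq i y y' h h')
  refine ⟨g, fun i y y' h h' => ?_, fun i hi => ?_⟩
  · exact huniq i y y' ((hg i y).1 h).2 ((hg i y').1 h').2
  · obtain ⟨s, hs⟩ := hM.sep (fun f => S i f) b
    have hsa : E s a' := (ha' s).2 ⟨i, hi, hs⟩
    obtain ⟨f, hfu, hf⟩ := hF.exists_maps hM hsa
    exact ⟨f, (hg i f).2 ⟨hi, s, hs, hf⟩, ((hs f).1 (hF' s f hsa hf)).2⟩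

/-- A union of `r` many sets covered by `r` is covered by `r`, if `r × r` is. -/
theorem Covers.iUnion {r X : M} {I : M → Prop} {Q : M → M → Prop} [hI : Dfn₁ E I]
    [hQ : Dfn₂ E Q] (hr : Covers E r fun p => ∃ a b, E a r ∧ E b r ∧ IsOPair E p a b)
    (h : Covers E r I) (hX : ∀ i z, I i → Q i z → E z X) (hQr : ∀ i, I i → Covers E r (Q i)) :
    Covers E r fun z => ∃ i, I i ∧ Q i z := by
  have := fun t s [IsTerm t] [IsTerm s] => hQ.subst t s
  have := fun t [IsTerm t] => hI.subst t
  obtain ⟨e, he, he'⟩ := h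
  obtain ⟨a, ha⟩ := hM.sep (fun k => ∃ i, Maps E e k i ∧ I i) r
  obtain ⟨c, hc⟩ := hM.exists_prod r X
  obtain ⟨B, hB⟩ := hM.powerset c
  obtain ⟨g, hg, hg'⟩ := hM.exists_choice a B
    (fun k f => SingleValued E f ∧ ∀ i, Maps E e k i → I i →
      ∀ z, Q i z → ∃ j, E j r ∧ Maps E f j z) (by
    intro k hk
    obtain ⟨hkr, i, hki, hi⟩ := (ha k).1 hk
    obtain ⟨f, hf, hf'⟩ := hQr i hi
    -- Cutting `f` down to a subset of `r × X` puts it in the power set `B` from which the choice is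
    -- made.
    obtain ⟨f₁, hf₁, hf₁'⟩ := hM.exists_rel (Maps E f) r X
    refine ⟨f₁, (hB f₁).2 fun p hp => (hc p).2 (hf₁ p hp), fun x y y' h h' => ?_,
      fun i' hki' hi' z hz => ?_⟩
    · exact hf x y y' ((hf₁' x y).1 h).2.2 ((hf₁' x y').1 h').2.2
    · obtain rfl := he _ _ _ hki hki'
      obtain ⟨j, hj, hjz⟩ := hf' z hz
      exact ⟨j, hj, (hf₁' j z).2 ⟨hj, hX i z hi hz, hjz⟩⟩)
  refine hr.image hM
    (fun p z => ∃ k j f, IsOPair E p k j ∧ Maps E g k f ∧ SingleValued E f ∧ Maps E f j z) ?_ ?_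
  · rintro p y y' - ⟨k, j, f, hp, hf, hsv, hy⟩ ⟨k', j', f', hp', hf', -, hy'⟩
    obtain ⟨rfl, rfl⟩ := hM.opair_inj hp hp'
    obtain rfl := hg _ _ _ hf hf'
    exact hsv _ _ _ hy hy'
  · rintro z ⟨i, hi, hz⟩
    obtain ⟨k, hk, hki⟩ := he' i hi
    obtain ⟨f, hkf, hsv, hf⟩ := hg' k ((ha k).2 ⟨hk, i, hki, hi⟩)
    obtain ⟨j, hj, hjz⟩ := hf i hki hi z hz
    obtain ⟨p, hp⟩ := hM.exists_opair k j
    exact ⟨p, ⟨k, j, hk, hj, hp⟩, k, j, f, hp, hkf, hsv, hjz⟩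

end Covering

/-! ### Finite sets in the sense of the model -/

section Finite

variable {M : Type*} {E : M → M → Prop} (hM : IsModelZFC E)
include hM

theorem IsLimitOrd.succ_mem {a y s : M} (ha : IsLimitOrd E a) (hy : E y a)
    (hs : IsSuccSet E s y) : E s a := by
  obtain ⟨z, hz, hyz⟩ := ha.2.2 y hy
  rcases ((ha.1.mem hy).succ hs).trichotomy hM (ha.1.mem hz) with h | rfl | h
  · exact ha.1.mem_trans hz h
  · exact hz
  · rcases (hs z).1 h with h | rfl
    · exact absurd ((ha.1.mem hy).mem_trans h hyz) (hM.irrefl y)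
    · exact absurd hyz (hM.irrefl z)

theorem IsLimitOrd.exists_omega {a : M} (ha : IsLimitOrd E a) : ∃ w, Le E w a ∧ IsOmega E w := by
  obtain ⟨w, hw, hlim, hmin⟩ := hM.exists_least (IsLimitOrd E) ha.1 ha
  exact ⟨w, hw, hlim, hmin⟩

theorem IsOrd.empty_or_succ_or_limit {n : M} (hn : IsOrd E n) :
    IsEmptySet E n ∨ (∃ m, IsSuccSet E n m) ∨ IsLimitOrd E n := by
  by_cases h0 : IsEmptySet E n
  · exact Or.inl h0
  by_cases hl : IsLimitOrd E n
  · exact Or.inr (Or.inr hl)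
  refine Or.inr (Or.inl ?_)
  have hne : ∃ y, E y n := by simpa [IsEmptySet] using h0
  have : ∃ y, E y n ∧ ∀ z, E z n → ¬ E y z := by
    by_contra hcon
    push Not at hcon
    exact hl ⟨hn, hne, fun y hy => (hcon y hy).imp fun z hz => hz⟩
  obtain ⟨y, hy, hmax⟩ := this
  refine ⟨y, fun z => ⟨fun hz => ?_, ?_⟩⟩
  · rcases (hn.mem hz).trichotomy hM (hn.mem hy) with h | h | h
    · exact Or.inl h
    · exact Or.inr h
    · exact absurd h (hmax z hz)
  · rintro (h | rfl)
    · exact hn.mem_trans hy h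
    · exact hy

theorem IsOmega.empty_or_succ {w n : M} (hw : IsOmega E w) (hn : E n w) :
    IsEmptySet E n ∨ ∃ m, E m w ∧ IsSuccSet E n m := by
  rcases (hw.1.1.mem hn).empty_or_succ_or_limit hM with h | ⟨m, hm⟩ | h
  · exact Or.inl h
  · exact Or.inr ⟨m, hw.1.1.mem_trans hn ((hm m).2 (Or.inr rfl)), hm⟩
  · exact absurd h (hw.2 n hn)

theorem Covers.insert {r s y : M} {P : M → Prop} (h : Covers E r P) (hs : IsSuccSet E s r) :
    Covers E s fun z => P z ∨ z = y := by
  obtain ⟨f, hf, hf'⟩ := h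
  have key : ∀ i z z', (E i r ∧ Maps E f i z ∨ i = r ∧ z = y) →
      (E i r ∧ Maps E f i z' ∨ i = r ∧ z' = y) → z = z' := by
    rintro i z z' (⟨hi, h⟩ | ⟨rfl, rfl⟩) (⟨hi', h'⟩ | ⟨h1, h2⟩)
    · exact hf _ _ _ h h'
    · subst h1; exact absurd hi (hM.irrefl i)
    · exact absurd hi' (hM.irrefl i)
    · exact h2.symm
  obtain ⟨g, hg⟩ := hM.exists_graph (fun i z => E i r ∧ Maps E f i z ∨ i = r ∧ z = y) s
    fun i _ z z' h h' => key i z z' h h'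
  refine ⟨g, fun i z z' h h' => key i z z' ((hg i z).1 h).2 ((hg i z').1 h').2, ?_⟩
  rintro z (hz | rfl)
  · obtain ⟨i, hi, hiz⟩ := hf' z hz
    have hi' : E i s := (hs i).2 (Or.inl hi)
    exact ⟨i, hi', (hg i z).2 ⟨hi', Or.inl ⟨hi, hiz⟩⟩⟩
  · have hr : E r s := (hs r).2 (Or.inr rfl)
    exact ⟨r, hr, (hg r z).2 ⟨hr, Or.inr ⟨rfl, rfl⟩⟩⟩

/-- Induction over the finite sets of the model. -/
theorem IsOmega.finite_induction {w : M} (hw : IsOmega E w) (P : M → Prop) [hP : Dfn₁ E P]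
    (h0 : ∀ e, IsEmptySet E e → P e)
    (h1 : ∀ x y x', P x → (∀ z, E z x' ↔ E z x ∨ z = y) → P x')
    {n x : M} (hn : E n w) (hx : Covers E n fun z => E z x) : P x := by
  have := fun t [IsTerm t] => hP.subst t
  refine hM.ord_induction (fun n => E n w → ∀ x, Covers E n (fun z => E z x) → P x)
    (hw.1.1.mem hn) (fun n _ ih hn x hx => ?_) hn x hx
  rcases hw.empty_or_succ hM hn with he | ⟨m, hmw, hm⟩
  · obtain ⟨f, -, hf⟩ := hx
    refine h0 x fun z hz => ?_
    obtain ⟨i, hi, -⟩ := hf z hz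
    exact he i hi
  · have hmn : E m n := (hm m).2 (Or.inr rfl)
    obtain ⟨f, hf, hf'⟩ := hx
    by_cases hy : ∃ y, Maps E f m y ∧ E y x
    · obtain ⟨y, hmy, hy⟩ := hy
      -- With the value at the last index `m` removed, the remaining elements have indices below
      -- `m`.
      obtain ⟨x', hx'⟩ := hM.sep (fun z => z ≠ y) x
      refine h1 x' y x (ih m hmn hmw x' ⟨f, hf, fun z hz => ?_⟩) fun z => ?_
      · obtain ⟨hzx, hzy⟩ := (hx' z).1 hz
        obtain ⟨i, hi, hiz⟩ := hf' z hzx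
        rcases (hm i).1 hi with hi | rfl
        · exact ⟨i, hi, hiz⟩
        · exact absurd (hf _ _ _ hiz hmy) hzy
      · rw [hx']
        by_cases hzy : z = y
        · simp [hzy, hy]
        · simp [hzy]
    · refine ih m hmn hmw x ⟨f, hf, fun z hz => ?_⟩
      obtain ⟨i, hi, hiz⟩ := hf' z hz
      rcases (hm i).1 hi with hi | rfl
      · exact ⟨i, hi, hiz⟩
      · exact absurd ⟨z, hiz, hz⟩ hy

theorem IsOmega.covers_union {w n m x y : M} (hw : IsOmega E w) (hn : E n w) (hm : E m w)
    (hx : Covers E n fun z => E z x) (hy : Covers E m fun z => E z y) :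
    ∃ k, E k w ∧ Covers E k fun z => E z x ∨ E z y := by
  refine hw.finite_induction hM (fun x => ∃ k, E k w ∧ Covers E k fun z => E z x ∨ E z y)
    (fun e he => ⟨m, hm, hy.mono fun z hz => hz.resolve_left (he z)⟩) ?_ hn hx
  rintro x a x' ⟨k, hk, hc⟩ hx'
  obtain ⟨s, hs⟩ := hM.exists_succ k
  refine ⟨s, hw.1.succ_mem hM hk hs, (hc.insert hM hs (y := a)).mono fun z hz => ?_⟩
  rw [hx'] at hz
  tauto

theorem IsOmega.covers_prod {w n m x y : M} (hw : IsOmega E w) (hn : E n w) (hm : E m w)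
    (hx : Covers E n fun z => E z x) (hy : Covers E m fun z => E z y) :
    ∃ k, E k w ∧ Covers E k fun p => ∃ a b, E a x ∧ E b y ∧ IsOPair E p a b := by
  refine hw.finite_induction hM
    (fun x => ∃ k, E k w ∧ Covers E k fun p => ∃ a b, E a x ∧ E b y ∧ IsOPair E p a b)
    (fun e he => ⟨m, hm, hy.choose, hy.choose_spec.1, fun p ⟨a, _, ha, _⟩ => absurd ha (he a)⟩)
    ?_ hn hx
  rintro x c x' ⟨k, hk, hc⟩ hx'
  obtain ⟨u, hu⟩ := hM.exists_prod x y
  obtain ⟨sc, hsc⟩ := hM.exists_singleton c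
  obtain ⟨v, hv⟩ := hM.exists_prod sc y
  obtain ⟨l, hl, hcl⟩ := hw.covers_union hM hk hm (x := u) (y := v)
    (hc.mono fun z hz => (hu z).1 hz)
    (hy.image hM (fun b p => IsOPair E p c b) (fun b p p' _ h h' => hM.opair_unique h h')
      fun p hp => by
        obtain ⟨a, b, ha, hb, hp⟩ := (hv p).1 hp
        rw [hsc] at ha
        subst ha
        exact ⟨b, hb, hp⟩)
  refine ⟨l, hl, hcl.mono fun p ⟨a, b, ha, hb, hp⟩ => ?_⟩
  rcases (hx' a).1 ha with ha | rfl
  · exact Or.inl ((hu p).2 ⟨a, b, ha, hb, hp⟩)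
  · exact Or.inr ((hv p).2 ⟨a, b, (hsc a).2 rfl, hb, hp⟩)

/-- By finite induction, the part of a finite set lying in `ω` is contained in some `m < ω`; for `ω`
itself this would give `m ∈ m`. -/
theorem IsOmega.not_covers {w n : M} (hw : IsOmega E w) (hn : E n w) :
    ¬ Covers E n fun z => E z w := by
  intro h
  obtain ⟨m, hm, hm'⟩ := hw.finite_induction hM
    (fun x => ∃ m, E m w ∧ ∀ z, E z x → E z w → E z m)
    (fun e he => ⟨n, hn, fun z hz => absurd hz (he z)⟩)
    (by
      rintro x y x' ⟨m, hm, hmx⟩ hx'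
      by_cases hy : E y w
      · obtain ⟨s, hs⟩ := hM.exists_succ y
        have hsw := hw.1.succ_mem hM hy hs
        rcases (hw.1.1.mem hm).le_total hM (hw.1.1.mem hsw) with hle | hle
        · refine ⟨s, hsw, fun z hz hzw => ?_⟩
          rcases (hx' z).1 hz with hz | rfl
          · exact hle.mem (hw.1.1.mem hsw) (hmx z hz hzw)
          · exact (hs z).2 (Or.inr rfl)
        · refine ⟨m, hm, fun z hz hzw => ?_⟩
          rcases (hx' z).1 hz with hz | rfl
          · exact hmx z hz hzw
          · exact hle.mem (hw.1.1.mem hm) ((hs z).2 (Or.inr rfl))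
      · refine ⟨m, hm, fun z hz hzw => ?_⟩
        rcases (hx' z).1 hz with hz | rfl
        · exact hmx z hz hzw
        · exact absurd hzw hy) hn h
  exact hM.irrefl m (hm' m hm hm)

/-- A disjoint union of two copies of `r` embeds in `r × r` by tagging with two distinct elements.
-/
theorem Covers.or {r e₀ e₁ : M} {P Q : M → Prop}
    (hr : Covers E r fun p => ∃ a b, E a r ∧ E b r ∧ IsOPair E p a b)
    (h₀ : E e₀ r) (h₁ : E e₁ r) (hne : e₀ ≠ e₁) (hP : Covers E r P) (hQ : Covers E r Q) :
    Covers E r fun z => P z ∨ Q z := by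
  obtain ⟨f, hf, hf'⟩ := hP
  obtain ⟨g, hg, hg'⟩ := hQ
  refine hr.image hM (fun p z => ∃ j, (IsOPair E p e₀ j ∧ Maps E f j z) ∨
    (IsOPair E p e₁ j ∧ Maps E g j z)) ?_ ?_
  · rintro p z z' - ⟨j, ⟨hp, h⟩ | ⟨hp, h⟩⟩ ⟨j', ⟨hp', h'⟩ | ⟨hp', h'⟩⟩ <;>
      obtain ⟨h1, rfl⟩ := hM.opair_inj hp hp'
    · exact hf _ _ _ h h'
    · exact absurd h1 hne
    · exact absurd h1.symm hne
    · exact hg _ _ _ h h'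
  · rintro z (hz | hz)
    · obtain ⟨i, hi, hiz⟩ := hf' z hz
      obtain ⟨p, hp⟩ := hM.exists_opair e₀ i
      exact ⟨p, ⟨e₀, i, h₀, hi, hp⟩, i, Or.inl ⟨hp, hiz⟩⟩
    · obtain ⟨i, hi, hiz⟩ := hg' z hz
      obtain ⟨p, hp⟩ := hM.exists_opair e₁ i
      exact ⟨p, ⟨e₁, i, h₁, hi, hp⟩, i, Or.inr ⟨hp, hiz⟩⟩

theorem IsModelZFC.covers_eq {r a : M} (b : M) (ha : E a r) : Covers E r fun z => z = b := by
  have hc : Covers E r fun z => z = a := (hM.covers_refl r).mono fun z hz => hz ▸ ha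
  exact hc.image hM (fun _ z => z = b) (fun _ _ _ _ h h' => h.trans h'.symm)
    fun z hz => ⟨a, rfl, hz⟩

theorem IsOmega.exists_pair_ne {w r : M} (hw : IsOmega E w) (hr : IsOrd E r) (hwr : Le E w r) :
    ∃ a b, E a r ∧ E b r ∧ a ≠ b := by
  obtain ⟨y, hy⟩ := hw.1.2.1
  obtain ⟨z, hz, hyz⟩ := hw.1.2.2 y hy
  refine ⟨y, z, hwr.mem hr hy, hwr.mem hr hz, ?_⟩
  rintro rfl
  exact hM.irrefl y hyz

end Finite

/-! ### Infinite cardinal arithmetic: squares and successor cardinals -/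

section Squares

variable {M : Type*} {E : M → M → Prop}

/-- `p = (a, b)` with `a, b < k` and `m = max a b`. -/
def IsPairWithMax (E : M → M → Prop) (k p m a b : M) : Prop :=
  IsOPair E p a b ∧ E a k ∧ E b k ∧ ((m = a ∧ Le E b a) ∨ (m = b ∧ Le E a b))

/-- The canonical well-order of `k × k`: by maximum, then lexicographically. -/
def PairLt (E : M → M → Prop) (k p q : M) : Prop :=
  ∃ m a b n c d, IsPairWithMax E k p m a b ∧ IsPairWithMax E k q n c d ∧
    (E m n ∨ m = n ∧ (E a c ∨ a = c ∧ E b d))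

instance Dfn.IsPairWithMax (t s r q u : (ℕ → M) → M) [IsTerm t] [IsTerm s] [IsTerm r] [IsTerm q]
    [IsTerm u] : Dfn E fun v => IsPairWithMax E (t v) (s v) (r v) (q v) (u v) := by
  unfold ModelST.IsPairWithMax; infer_instance

instance Dfn.PairLt (t s r : (ℕ → M) → M) [IsTerm t] [IsTerm s] [IsTerm r] :
    Dfn E fun v => PairLt E (t v) (s v) (r v) := by
  unfold ModelST.PairLt; infer_instance

variable (hM : IsModelZFC E)
include hM

theorem IsPairWithMax.unique {k p m a b m' a' b' : M} (hk : IsOrd E k)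
    (h : IsPairWithMax E k p m a b) (h' : IsPairWithMax E k p m' a' b') :
    m = m' ∧ a = a' ∧ b = b' := by
  obtain ⟨hp, ha, hb, hm⟩ := h
  obtain ⟨hp', ha', hb', hm'⟩ := h'
  obtain ⟨rfl, rfl⟩ := hM.opair_inj hp hp'
  refine ⟨?_, rfl, rfl⟩
  have key : Le E a b → Le E b a → a = b := by
    rintro (h | h) h'
    · exact absurd h ((hk.mem ha).not_mem_of_le hM h')
    · exact h
  rcases hm with ⟨rfl, h⟩ | ⟨rfl, h⟩ <;> rcases hm' with ⟨rfl, h'⟩ | ⟨rfl, h'⟩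
  · rfl
  · exact key h' h
  · exact (key h h').symm
  · rfl

theorem IsModelZFC.exists_isPairWithMax {k p a b : M} (hk : IsOrd E k) (hp : IsOPair E p a b)
    (ha : E a k) (hb : E b k) : ∃ m, E m k ∧ IsPairWithMax E k p m a b := by
  rcases (hk.mem ha).le_total hM (hk.mem hb) with h | h
  · exact ⟨b, hb, hp, ha, hb, Or.inr ⟨rfl, h⟩⟩
  · exact ⟨a, ha, hp, ha, hb, Or.inl ⟨rfl, h⟩⟩

omit hM in
theorem IsPairWithMax.max_mem {k p m a b : M} (h : IsPairWithMax E k p m a b) :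
    E m k ∧ Le E a m ∧ Le E b m := by
  obtain ⟨-, ha, hb, ⟨rfl, h⟩ | ⟨rfl, h⟩⟩ := h
  · exact ⟨ha, Le.refl _, h⟩
  · exact ⟨hb, h, Le.refl _⟩

theorem IsModelZFC.isWellOrderOn_pairLt {k A : M} (hk : IsOrd E k)
    (hA : ∀ p, E p A ↔ ∃ x y, E x k ∧ E y k ∧ IsOPair E p x y) :
    IsWellOrderOn E A (PairLt E k) := by
  have hex : ∀ p, E p A → ∃ m a b, IsPairWithMax E k p m a b := by
    intro p hp
    obtain ⟨a, b, ha, hb, hp⟩ := (hA p).1 hp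
    obtain ⟨m, -, hm⟩ := hM.exists_isPairWithMax hk hp ha hb
    exact ⟨m, a, b, hm⟩
  refine ⟨fun s hs => ?_, fun p q r hp hq hr => ?_, fun p q hp hq hne => ?_⟩
  · rintro ⟨p₀, hp₀⟩
    obtain ⟨m₀, a₀, b₀, h₀⟩ := hex p₀ (hs p₀ hp₀)
    obtain ⟨m, -, ⟨p₁, hp₁, a₁, b₁, h₁⟩, hm⟩ := hM.exists_least
      (fun m => ∃ p, E p s ∧ ∃ a b, IsPairWithMax E k p m a b) (hk.mem (h₀.max_mem).1)
      ⟨p₀, hp₀, a₀, b₀, h₀⟩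
    obtain ⟨a, -, ⟨p₂, hp₂, b₂, h₂⟩, ha⟩ := hM.exists_least
      (fun a => ∃ p, E p s ∧ ∃ b, IsPairWithMax E k p m a b) (hk.mem h₁.2.1) ⟨p₁, hp₁, b₁, h₁⟩
    obtain ⟨b, -, ⟨p, hp, h⟩, hb⟩ := hM.exists_least
      (fun b => ∃ p, E p s ∧ IsPairWithMax E k p m a b) (hk.mem h₂.2.2.1) ⟨p₂, hp₂, h₂⟩
    refine ⟨p, hp, ?_⟩
    rintro z hz ⟨m', a', b', n, c, d, hz', hp', hlt⟩
    obtain ⟨rfl, rfl, rfl⟩ := h.unique hM hk hp'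
    rcases hlt with hlt | ⟨rfl, hlt | ⟨rfl, hlt⟩⟩
    · exact hm m' hlt ⟨z, hz, a', b', hz'⟩
    · exact ha a' hlt ⟨z, hz, b', hz'⟩
    · exact hb b' hlt ⟨z, hz, hz'⟩
  · rintro ⟨m, a, b, n, c, d, hp', hq', hlt⟩ ⟨n', c', d', l, e, f, hq'', hr', hlt'⟩
    obtain ⟨rfl, rfl, rfl⟩ := hq'.unique hM hk hq''
    refine ⟨m, a, b, l, e, f, hp', hr', ?_⟩
    have hl := hk.mem (hr'.max_mem).1
    have he := hk.mem hr'.2.1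
    have hf := hk.mem hr'.2.2.1
    rcases hlt with hlt | ⟨rfl, hlt⟩
    · rcases hlt' with hlt' | ⟨rfl, hlt'⟩
      · exact Or.inl (hl.mem_trans hlt' hlt)
      · exact Or.inl hlt
    · rcases hlt' with hlt' | ⟨rfl, hlt'⟩
      · exact Or.inl hlt'
      · refine Or.inr ⟨rfl, ?_⟩
        rcases hlt with hlt | ⟨rfl, hlt⟩
        · rcases hlt' with hlt' | ⟨rfl, hlt'⟩
          · exact Or.inl (he.mem_trans hlt' hlt)
          · exact Or.inl hlt
        · rcases hlt' with hlt' | ⟨rfl, hlt'⟩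
          · exact Or.inl hlt'
          · exact Or.inr ⟨rfl, hf.mem_trans hlt' hlt⟩
  · obtain ⟨m, a, b, hp'⟩ := hex p hp
    obtain ⟨n, c, d, hq'⟩ := hex q hq
    rcases (hk.mem (hp'.max_mem).1).trichotomy hM (hk.mem (hq'.max_mem).1) with h | rfl | h
    · exact Or.inl ⟨m, a, b, n, c, d, hp', hq', Or.inl h⟩
    · rcases (hk.mem hp'.2.1).trichotomy hM (hk.mem hq'.2.1) with h | rfl | h
      · exact Or.inl ⟨m, a, b, m, c, d, hp', hq', Or.inr ⟨rfl, Or.inl h⟩⟩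
      · rcases (hk.mem hp'.2.2.1).trichotomy hM (hk.mem hq'.2.2.1) with h | rfl | h
        · exact Or.inl ⟨m, a, b, m, a, d, hp', hq', Or.inr ⟨rfl, Or.inr ⟨rfl, h⟩⟩⟩
        · exact absurd (hM.opair_unique hp'.1 hq'.1) hne
        · exact Or.inr ⟨m, a, d, m, a, b, hq', hp', Or.inr ⟨rfl, Or.inr ⟨rfl, h⟩⟩⟩
      · exact Or.inr ⟨m, c, d, m, a, b, hq', hp', Or.inr ⟨rfl, Or.inl h⟩⟩
    · exact Or.inr ⟨n, c, d, m, a, b, hq', hp', Or.inl h⟩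

/-- Gödel's canonical ordering of `k × k` has order type at most `k`: a pair with maximum `m` has
all its predecessors in `(m + 1)²`, and by induction this set has size below `k`. -/
theorem IsOmega.square_of_card {w k : M} (hw : IsOmega E w) (hk : IsCard E k) (hwk : Le E w k)
    (ih : ∀ c, E c k → Le E w c →
      Covers E c fun p => ∃ a b, E a c ∧ E b c ∧ IsOPair E p a b) :
    Covers E k fun p => ∃ a b, E a k ∧ E b k ∧ IsOPair E p a b := by
  -- That `k` is a limit is checked by hand from `ih`, because `IsCard.isLimitOrd` itself rests on
  -- the square theorem.
  have hsucc : ∀ m s, E m k → IsSuccSet E s m → E s k := by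
    intro m s hm hs
    have hmo := hk.1.mem hm
    have hso := hmo.succ hs
    rcases hso.lt_or_le hM hk.1 with h | h
    · exact h
    have hks : k = s := by
      rcases h with h | h
      · rcases (hs k).1 h with h | rfl
        · exact absurd (hk.1.mem_trans hm h) (hM.irrefl k)
        · exact absurd hm (hM.irrefl k)
      · exact h
    subst hks
    rcases hmo.lt_or_le hM hw.1.1 with hmw | hwm
    · exact absurd (hwk.mem hk.1 (hw.1.succ_mem hM hmw hs)) (hM.irrefl k)
    · exfalso
      obtain ⟨a, b, ha, hb, hab⟩ := hw.exists_pair_ne hM hmo hwm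
      refine hk.not_covers hM hm (((ih m hm hwm).or hM ha hb hab (hM.covers_refl m)
        (hM.covers_eq m ha)).mono ?_)
      exact fun z hz => (hs z).1 hz
  have hsmall : ∀ d, E d k → ∃ e, E e k ∧
      Covers E e fun p => ∃ a b, E a d ∧ E b d ∧ IsOPair E p a b := by
    intro d hd
    rcases (hk.1.mem hd).lt_or_le hM hw.1.1 with hdw | hwd
    · obtain ⟨e, he, hc⟩ := hw.covers_prod hM hdw hdw (hM.covers_refl d) (hM.covers_refl d)
      exact ⟨e, hwk.mem hk.1 he, hc⟩
    · exact ⟨d, hd, ih d hd hwd⟩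
  obtain ⟨A, hA⟩ := hM.exists_prod k k
  obtain ⟨T, g, hT, hg, hgR⟩ := (hM.isWellOrderOn_pairLt hk.1 hA).exists_ordinal hM
  rcases hk.1.lt_or_le hM hT with hkT | hTk
  · exfalso
    obtain ⟨p, hp, hkp⟩ := hg.1.exists_maps hM hkT
    obtain ⟨a, b, ha, hb, hpab⟩ := (hA p).1 hp
    obtain ⟨m, hm, hpm⟩ := hM.exists_isPairWithMax hk.1 hpab ha hb
    obtain ⟨s, hs⟩ := hM.exists_succ m
    obtain ⟨e, he, hc⟩ := hsmall s (hsucc m s hm hs)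
    -- If the order type exceeded `k`, the `k` many predecessors of the pair in position `k` would
    -- all lie in `s × s`, which is covered by `e < k`.
    refine hk.not_covers hM he (hc.image hM (fun q i => Maps E g i q)
      (fun q i i' _ h h' => hg.2.1 _ _ _ h h') fun i hi => ?_)
    obtain ⟨q, hq, hiq⟩ := hg.1.exists_maps hM (hT.mem_trans hkT hi)
    obtain ⟨n, c, d, m', a', b', hq', hp', hlt⟩ := (hgR i k q p hiq hkp).1 hi
    obtain ⟨rfl, rfl, rfl⟩ := hpm.unique hM hk.1 hp'
    obtain ⟨hnk, hcn, hdn⟩ := hq'.max_mem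
    have hnm : Le E n m := by
      rcases hlt with h | ⟨rfl, -⟩
      · exact Or.inl h
      · exact Le.refl _
    have hmo := hk.1.mem hm
    exact ⟨q, ⟨c, d, (hs c).2 (hcn.trans hmo hnm), (hs d).2 (hdn.trans hmo hnm), hq'.1⟩, hiq⟩
  · exact ((hg.covers hM).mono_left (hTk.sub hk.1)).mono fun p hp => (hA p).2 hp

/-- `|k × k| ≤ k` for every infinite ordinal `k`. -/
theorem IsOmega.square {w k : M} (hw : IsOmega E w) (hk : IsOrd E k) (hwk : Le E w k) :
    Covers E k fun p => ∃ a b, E a k ∧ E b k ∧ IsOPair E p a b := by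
  refine hM.ord_induction (fun k => Le E w k →
    Covers E k fun p => ∃ a b, E a k ∧ E b k ∧ IsOPair E p a b) hk (fun k hk' ih hwk => ?_) hwk
  replace hk := hk'.isOrd hk
  by_cases hcard : IsCard E k
  · exact hw.square_of_card hM hcard hwk ih
  · have : ∃ a, E a k ∧ ∃ f, IsBij E f a k := by
      by_contra hcon
      exact hcard ⟨hk, fun a ha hf => hcon ⟨a, ha, hf⟩⟩
    obtain ⟨a, ha, f, hf⟩ := this
    have hao := hk.mem ha
    rcases hao.lt_or_le hM hw.1.1 with haw | hwa
    · exact absurd ((hf.covers hM).mono fun z hz => hwk.mem hk hz) (hw.not_covers hM haw)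
    · refine Covers.mono_left ?_ (hk.1 a ha)
      refine (ih a ha hwa).image hM
        (fun p q => ∃ x y x' y', IsOPair E p x y ∧ Maps E f x x' ∧ Maps E f y y' ∧ IsOPair E q x' y')
        ?_ ?_
      · rintro p q q' - ⟨x, y, x', y', h1, h2, h3, h4⟩ ⟨u, v, u', v', h1', h2', h3', h4'⟩
        obtain ⟨rfl, rfl⟩ := hM.opair_inj h1 h1'
        obtain rfl := hf.1.maps_unique hM h2 h2'
        obtain rfl := hf.1.maps_unique hM h3 h3'
        exact hM.opair_unique h4 h4'
      · rintro q ⟨x', y', hx', hy', hq⟩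
        obtain ⟨x, hx, hxx⟩ := hf.2.2 x' hx'
        obtain ⟨y, hy, hyy⟩ := hf.2.2 y' hy'
        obtain ⟨p, hp⟩ := hM.exists_opair x y
        exact ⟨p, ⟨x, y, hx, hy, hp⟩, x, y, x', y', hp, hxx, hyy, hq⟩

theorem IsOmega.covers_or {w k : M} (hw : IsOmega E w) (hk : IsOrd E k) (hwk : Le E w k)
    {P Q : M → Prop} (hP : Covers E k P) (hQ : Covers E k Q) :
    Covers E k fun z => P z ∨ Q z := by
  obtain ⟨a, b, ha, hb, hab⟩ := hw.exists_pair_ne hM hk hwk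
  exact (hw.square hM hk hwk).or hM ha hb hab hP hQ

theorem IsOmega.covers_succ {w k s : M} (hw : IsOmega E w) (hk : IsOrd E k) (hwk : Le E w k)
    (hs : IsSuccSet E s k) : Covers E k fun z => E z s := by
  obtain ⟨a, b, ha, hb, hab⟩ := hw.exists_pair_ne hM hk hwk
  exact (hw.covers_or hM hk hwk (hM.covers_refl k) (hM.covers_eq k ha)).mono fun z => (hs z).1

theorem IsCard.isLimitOrd {w k : M} (hw : IsOmega E w) (hk : IsCard E k) (hwk : Le E w k) :
    IsLimitOrd E k := by
  rcases hk.1.empty_or_succ_or_limit hM with h | ⟨m, hm⟩ | h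
  · obtain ⟨a, b, ha, -⟩ := hw.exists_pair_ne hM hk.1 hwk
    exact absurd ha (h a)
  · have hmk : E m k := (hm m).2 (Or.inr rfl)
    have hmo := hk.1.mem hmk
    rcases hmo.lt_or_le hM hw.1.1 with h | h
    · have := hw.1.succ_mem hM h hm
      exact absurd (hwk.mem hk.1 this) (hM.irrefl k)
    · exact absurd (hw.covers_succ hM hmo h hm) (hk.not_covers hM hmk)
  · exact h

theorem IsSuccCard.covers_of_mem {c d a : M} (hd : IsSuccCard E d c) (ha : E a d) :
    Covers E c fun z => E z a := by
  have hao := hd.1.1.mem ha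
  have hco := hd.1.1.mem hd.2.1
  obtain ⟨e, he, he', f, hf⟩ := (hM.covers_refl a).exists_hasCard hM hao
  rcases hco.lt_or_le hM he'.1 with h | h
  · exact absurd ((hd.2.2 e he' h).mem he'.1 ha) (hao.not_mem_of_le hM he)
  · exact (hf.covers hM).mono_left (h.sub hco)

/-- Successors of infinite cardinals are regular. -/
theorem IsSuccCard.isRegularCard {w c d : M} (hw : IsOmega E w) (hd : IsSuccCard E d c)
    (hwc : Le E w c) : IsRegularCard E d := by
  have hdo := hd.1.1
  have hco := hdo.mem hd.2.1
  have hlim := hd.1.isLimitOrd hM hw (hwc.trans hdo (Or.inl hd.2.1))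
  refine ⟨hd.1, hlim, hdo, ?_, ?_⟩
  · obtain ⟨f, hf, hf'⟩ := hM.exists_func (fun x y => x = y) d d (fun x hx => ⟨x, hx, rfl⟩)
      (fun _ _ _ _ _ _ h h' => h.symm.trans h')
    exact ⟨f, hf, fun b hb => ⟨b, b, hb, (hf' b b).2 ⟨hb, hb, rfl⟩, Le.refl b⟩⟩
  · rintro s hs ⟨f, hf, hcof⟩
    -- A cofinal map from `s < d` would exhibit `d` as the union of at most `c` sets `f(i) + 1`,
    -- each of size at most `c`.
    refine hd.1.not_covers hM hd.2.1 (Covers.mono (Covers.iUnion hM (hw.square hM hco hwc)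
      (hd.covers_of_mem hM hs) (X := d) (Q := fun i z => ∃ y, Maps E f i y ∧ Le E z y) ?_ ?_) ?_)
    · rintro i z - ⟨y, hy, hzy⟩
      have hyd := (hf.maps_mem hM hy).2
      rcases hzy with h | rfl
      · exact hdo.mem_trans hyd h
      · exact hyd
    · intro i hi
      obtain ⟨y, hy, hiy⟩ := hf.exists_maps hM hi
      obtain ⟨t, ht⟩ := hM.exists_succ y
      refine (hd.covers_of_mem hM (hlim.succ_mem hM hy ht)).mono ?_
      rintro z ⟨y', hy', hz⟩
      obtain rfl := hf.maps_unique hM hiy hy'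
      exact (ht z).2 hz
    · intro z hz
      obtain ⟨x, y, hx, hxy, hzy⟩ := hcof z hz
      exact ⟨x, hx, y, hxy, hzy⟩

end Squares

/-! ### Cofinal maps and the cardinals below `κ^{+θ⁺}` -/

section Cofinality

variable {M : Type*} {E : M → M → Prop}

/-- A partial function on `t` takes values in the limit ordinal `a` that are unbounded in `a`. -/
def CofinalFrom (E : M → M → Prop) (t a : M) : Prop :=
  ∃ f, SingleValued E f ∧ ∀ z, E z a → ∃ i y, E i t ∧ E y a ∧ Maps E f i y ∧ E z y

variable (hM : IsModelZFC E)
include hM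

theorem HasCofinalMap.cofinalFrom {t a : M} (h : HasCofinalMap E t a) (ha : IsLimitOrd E a) :
    CofinalFrom E t a := by
  obtain ⟨f, hf, hcof⟩ := h
  refine ⟨f, fun x y y' h h' => hf.maps_unique hM h h', fun z hz => ?_⟩
  obtain ⟨z', hz', hzz'⟩ := ha.2.2 z hz
  obtain ⟨i, y, hi, hy, hle⟩ := hcof z' hz'
  have hya := (hf.maps_mem hM hy).2
  exact ⟨i, y, hi, hya, hy, hle.mem (ha.1.mem hya) hzz'⟩

/-- A cardinal `n` with `k ≤ n < k^{+t⁺}` is regular or has cofinality at most `t`. -/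
theorem IsCardShift.regular_or_cofinalFrom {w t s k m l n : M} (hw : IsOmega E w)
    (hwt : Le E w t) (htk : E t k) (hk : IsRegularCard E k) (hs : IsSuccCard E s t)
    (hm : IsCardShift E k s m) (hlm : Le E l m) (hn : IsCard E n) (hkn : Le E k n)
    (hnl : E n l) : IsRegularCard E n ∨ CofinalFrom E t n := by
  obtain ⟨hso, s', u, f, hs', hf, h0, hsucc, hlim, hfm⟩ := hm
  have hslim : IsLimitOrd E s := hs.1.isLimitOrd hM hw (hwt.trans hso (Or.inl hs.2.1))
  have hss' : E s s' := (hs' s).2 (Or.inr rfl)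
  have hsub : ∀ c, E c s → E c s' := fun c hc => (hs' c).2 (Or.inl hc)
  have hnext : ∀ g x, E g s → Maps E f g x →
      ∃ g' y, E g' s ∧ IsSuccSet E g' g ∧ Maps E f g' y ∧ IsSuccCard E y x := by
    intro g x hg hx
    obtain ⟨g', hg'⟩ := hM.exists_succ g
    have hgs := hslim.succ_mem hM hg hg'
    obtain ⟨y, -, hy⟩ := hf.exists_maps hM (hsub g' hgs)
    exact ⟨g', y, hgs, hg', hy, hsucc g g' x y hg hg' hx hy⟩
  have hnm : ∃ g x, E g s ∧ Maps E f g x ∧ E n x := by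
    rcases hlm with hlm | rfl
    · obtain ⟨g, x, hg, hx, hlx⟩ := (hlim s m hss' hslim hfm l).1 hlm
      obtain ⟨g', y, -, -, -, hy⟩ := hnext g x hg hx
      exact ⟨g, x, hg, hx, (hy.1.1.mem hy.2.1).mem_trans hlx hnl⟩
    · exact (hlim s l hss' hslim hfm n).1 hnl
  obtain ⟨g₀, x₀, hg₀, hx₀, hnx₀⟩ := hnm
  -- The least `b` with `n < f(b)` is neither `0` nor a limit. Hence `b = c + 1` and `f(c) ≤ n <
  -- f(c)⁺`, so the cardinal `n` equals `f(c)`.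
  obtain ⟨b, hb, ⟨y, hby, hny⟩, hmin⟩ := hM.exists_least
    (fun b => ∃ y, Maps E f b y ∧ E n y) (hso.mem hg₀) ⟨x₀, hx₀, hnx₀⟩
  have hbs : E b s := by
    rcases hb with hb | rfl
    · exact hso.mem_trans hg₀ hb
    · exact hg₀
  have hc : ∃ c, E c s ∧ Maps E f c n := by
    rcases (hso.mem hbs).empty_or_succ_or_limit hM with h | ⟨c, hc⟩ | h
    · obtain rfl := hf.maps_unique hM hby (h0 b h)
      exact absurd hny (hn.1.not_mem_of_le hM hkn)
    · have hcb : E c b := (hc c).2 (Or.inr rfl)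
      have hcs := hso.mem_trans hbs hcb
      obtain ⟨x, -, hcx⟩ := hf.exists_maps hM (hsub c hcs)
      have hyx := hsucc c b x y hcs hc hcx hby
      have hnx : ¬ E n x := fun h => hmin c hcb ⟨x, hcx, h⟩
      rcases hn.1.trichotomy hM (hyx.1.1.mem hyx.2.1) with h | rfl | h
      · exact absurd h hnx
      · exact ⟨c, hcs, hcx⟩
      · exact absurd hny (hn.1.not_mem_of_le hM (hyx.2.2 n hn h))
    · obtain ⟨g, x, hg, hx, hnx⟩ := (hlim b y (hsub b hbs) h hby n).1 hny
      exact absurd ⟨x, hx, hnx⟩ (hmin g hg)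
  obtain ⟨c, hcs, hcn⟩ := hc
  rcases (hso.mem hcs).empty_or_succ_or_limit hM with h | ⟨e, he⟩ | h
  · obtain rfl := hf.maps_unique hM hcn (h0 c h)
    exact Or.inl hk
  · left
    rcases hkn with hkn | rfl
    · have hes := hso.mem_trans hcs ((he e).2 (Or.inr rfl))
      obtain ⟨x, -, hex⟩ := hf.exists_maps hM (hsub e hes)
      have hnx := hsucc e c x n hes he hex hcn
      have hxo := hn.1.mem hnx.2.1
      rcases hxo.lt_or_le hM (hn.1.mem hkn) with h | h
      · exact absurd hkn (hk.1.1.not_mem_of_le hM (hnx.2.2 k hk.1 h))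
      · exact hnx.isRegularCard hM hw (hwt.trans hxo (Le.trans hxo (Or.inl htk) h))
    · exact hk
  · right
    -- For limit `c < t⁺`, a partial surjection from `t` onto `c` composed with `f` is cofinal in `n
    -- = sup f(g)`.
    obtain ⟨d, hd, hd'⟩ := hs.covers_of_mem hM hcs
    obtain ⟨q, hq⟩ := hM.exists_graph (fun i y => ∃ g, Maps E d i g ∧ Maps E f g y) t (by
      rintro i - y y' ⟨g, h1, h2⟩ ⟨g', h1', h2'⟩
      obtain rfl := hd _ _ _ h1 h1'
      exact hf.maps_unique hM h2 h2')
    refine ⟨q, fun i y y' h h' => ?_, fun z hz => ?_⟩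
    · obtain ⟨-, g, h1, h2⟩ := (hq i y).1 h
      obtain ⟨-, g', h1', h2'⟩ := (hq i y').1 h'
      obtain rfl := hd _ _ _ h1 h1'
      exact hf.maps_unique hM h2 h2'
    · have hlimc := hlim c n (hsub c hcs) h hcn
      obtain ⟨g, x, hg, hgx, hzx⟩ := (hlimc z).1 hz
      obtain ⟨g', y, -, hg', hgy, hyx⟩ := hnext g x (hso.mem_trans hcs hg) hgx
      obtain ⟨i, hi, hig⟩ := hd' g hg
      exact ⟨i, x, hi, (hlimc x).2 ⟨g', y, h.succ_mem hM hg hg', hgy, hyx.2.1⟩,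
        (hq i x).2 ⟨hi, g, hig, hgx⟩, hzx⟩

/-- A bijection from a smaller ordinal onto `t`, followed by the cofinal map, would contradict
minimality of `t`. -/
theorem HasCof.isCard {a t : M} (h : HasCof E a t) : IsCard E t := by
  obtain ⟨hto, ⟨f, hf, hcof⟩, hmin⟩ := h
  refine ⟨hto, ?_⟩
  rintro b hb ⟨g, hg⟩
  obtain ⟨q, hq, hq'⟩ := hM.exists_func (fun i y => ∃ j, Maps E g i j ∧ Maps E f j y) b a
    (fun i hi => by
      obtain ⟨j, hj, hij⟩ := hg.1.exists_maps hM hi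
      obtain ⟨y, hy, hjy⟩ := hf.exists_maps hM hj
      exact ⟨y, hy, j, hij, hjy⟩)
    (by
      rintro i y y' - - - ⟨j, h1, h2⟩ ⟨j', h1', h2'⟩
      obtain rfl := hg.1.maps_unique hM h1 h1'
      exact hf.maps_unique hM h2 h2')
  refine hmin b hb ⟨q, hq, fun z hz => ?_⟩
  obtain ⟨j, y, hj, hjy, hzy⟩ := hcof z hz
  obtain ⟨i, hi, hij⟩ := hg.2.2 j hj
  exact ⟨i, y, hi, (hq' i y).2 ⟨hi, (hf.maps_mem hM hjy).2, j, hij, hjy⟩, hzy⟩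

end Cofinality

/-! ### Sets of size less than `κ` -/

section Small

variable {M : Type*} {E : M → M → Prop}

/-- `|x| < k`. -/
def Small (E : M → M → Prop) (k x : M) : Prop :=
  ∃ d, E d k ∧ Covers E d fun z => E z x

variable (hM : IsModelZFC E)
include hM

theorem small_iff_hasCard {k x : M} (hk : IsOrd E k) :
    Small E k x ↔ ∃ c, E c k ∧ HasCard E x c := by
  constructor
  · rintro ⟨d, hd, hc⟩
    obtain ⟨c, hcd, hc⟩ := hc.exists_hasCard hM (hk.mem hd)
    refine ⟨c, ?_, hc⟩
    rcases hcd with h | rfl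
    · exact hk.mem_trans hd h
    · exact hd
  · rintro ⟨c, hc, -, f, hf⟩
    exact ⟨c, hc, hf.covers hM⟩

theorem IsOmega.small_union {w k x y u : M} (hw : IsOmega E w) (hk : IsOrd E k) (hwk : E w k)
    (hx : Small E k x) (hy : Small E k y) (hu : ∀ z, E z u ↔ E z x ∨ E z y) : Small E k u := by
  obtain ⟨d, hd, hdx⟩ := hx
  obtain ⟨e, he, hey⟩ := hy
  have hmax : ∀ a b, E a k → E b k → ∃ c, E c k ∧ Le E a c ∧ Le E b c := by
    intro a b ha hb
    rcases (hk.mem ha).le_total hM (hk.mem hb) with h | h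
    · exact ⟨b, hb, h, Le.refl b⟩
    · exact ⟨a, ha, Le.refl a, h⟩
  obtain ⟨a, ha, hda, hea⟩ := hmax d e hd he
  obtain ⟨c, hc, hac, hwc⟩ := hmax a w ha hwk
  have hco := hk.mem hc
  exact ⟨c, hc, (hw.covers_or hM hco hwc (hdx.mono_left ((hda.trans hco hac).sub hco))
    (hey.mono_left ((hea.trans hco hac).sub hco))).mono fun z hz => (hu z).1 hz⟩

end Small

/-! ### Closure under finite unions, and chains of type `ω` -/

section Unions

variable {M : Type*} {E : M → M → Prop}

/-- `z = x ∪ y`. -/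
def IsUnion₂ (E : M → M → Prop) (z x y : M) : Prop := ∀ t, E t z ↔ E t x ∨ E t y

/-- `c` contains the empty set and is closed under binary unions. -/
def UnionClosed (E : M → M → Prop) (c : M) : Prop :=
  (∃ e, E e c ∧ IsEmptySet E e) ∧ ∀ x y, E x c → E y c → ∃ z, E z c ∧ IsUnion₂ E z x y

/-- `z` is the least union-closed subset of `q` that contains `f(i)`, for `i < a`. -/
def IsUnionClosure (E : M → M → Prop) (q f a z : M) : Prop :=
  Sub E z q ∧ UnionClosed E z ∧ (∀ i x, E i a → Maps E f i x → E x q → E x z) ∧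
    ∀ c, UnionClosed E c → (∀ i x, E i a → Maps E f i x → E x q → E x c) → Sub E z c

instance Dfn.IsUnion₂ (t s r : (ℕ → M) → M) [IsTerm t] [IsTerm s] [IsTerm r] :
    Dfn E fun v => IsUnion₂ E (t v) (s v) (r v) := by
  unfold ModelST.IsUnion₂; infer_instance

instance Dfn.UnionClosed (t : (ℕ → M) → M) [IsTerm t] :
    Dfn E fun v => UnionClosed E (t v) := by
  unfold ModelST.UnionClosed; infer_instance

instance Dfn.IsUnionClosure (t s r q : (ℕ → M) → M) [IsTerm t] [IsTerm s] [IsTerm r] [IsTerm q] :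
    Dfn E fun v => IsUnionClosure E (t v) (s v) (r v) (q v) := by
  unfold ModelST.IsUnionClosure; infer_instance

variable (hM : IsModelZFC E)
include hM

theorem UnionClosed.mem {c x y z : M} (hc : UnionClosed E c) (hx : E x c) (hy : E y c)
    (hz : IsUnion₂ E z x y) : E z c := by
  obtain ⟨z', hz'c, hz'⟩ := hc.2 x y hx hy
  rwa [hM.ext fun t => (hz t).trans (hz' t).symm]

theorem UnionClosed.empty_mem {c e : M} (hc : UnionClosed E c) (he : IsEmptySet E e) : E e c := by
  obtain ⟨e', he'c, he'⟩ := hc.1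
  rwa [hM.ext fun t => iff_of_false (he t) (he' t)]

omit hM in
theorem IsUnionClosure.sub_of_le {q f a b z z' : M} (hb : IsOrd E b) (hab : Le E a b)
    (hz : IsUnionClosure E q f a z) (hz' : IsUnionClosure E q f b z') : Sub E z z' :=
  hz.2.2.2 z' hz'.2.1 fun i x hi => hz'.2.2.1 i x (hab.mem hb hi)

/-- Finite unions are sorted by the largest index used: the closure of `f ↾ a` consists of `∅` and
the sets `t ∪ f(b)` with `b < a` and `t` in the closure of `f ↾ b`. Induction on `a` then bounds the
size by `r · r = r`, without counting finite subsets. -/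
theorem IsOmega.exists_isUnionClosure {w r q f : M} (hw : IsOmega E w) (hr : IsOrd E r)
    (hwr : Le E w r) (hq : UnionClosed E q) (hf : SingleValued E f) :
    ∃ z, IsUnionClosure E q f r z ∧ Covers E r fun x => E x z := by
  refine hM.ord_induction (fun a => Le E a r →
    ∃ z, IsUnionClosure E q f a z ∧ Covers E r fun x => E x z) hr (fun a ha ih _ => ?_) (Le.refl r)
  have hao := ha.isOrd hr
  replace ih : ∀ b, E b a → ∃ z, IsUnionClosure E q f b z ∧ Covers E r fun x => E x z :=
    fun b hb => ih b hb (Or.inl (ha.mem hr hb))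
  have huniq : ∀ {b z z'}, IsUnionClosure E q f b z → IsUnionClosure E q f b z' → z = z' :=
    fun h h' => hM.ext fun x =>
      ⟨h.2.2.2 _ h'.2.1 h'.2.2.1 x, h'.2.2.2 _ h.2.1 h.2.2.1 x⟩
  obtain ⟨z, hz⟩ := hM.sep (fun x => IsEmptySet E x ∨ ∃ b, E b a ∧ ∃ z t y,
    IsUnionClosure E q f b z ∧ E t z ∧ Maps E f b y ∧ E y q ∧ IsUnion₂ E x t y) q
  have hzq : Sub E z q := fun x hx => ((hz x).1 hx).1
  have hmem : ∀ {b z' t y x}, E b a → IsUnionClosure E q f b z' → E t z' → Maps E f b y →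
      E y q → IsUnion₂ E x t y → E x z := fun hb hz' ht hy hyq hx =>
    (hz _).2 ⟨hq.mem hM (hz'.1 _ ht) hyq hx, Or.inr ⟨_, hb, _, _, _, hz', ht, hy, hyq, hx⟩⟩
  obtain ⟨e, heq, he⟩ := hq.1
  -- For `b < c`, the sets `t`, `f(b)` and `t'` all lie in the closure of `f ↾ c`, so only `f(c)` is
  -- adjoined last; for `b = c` the two adjoined sets coincide.
  have hunion : ∀ {x y b c t t' s s' zb zc u}, IsUnion₂ E x t s → IsUnion₂ E y t' s' →
      E b a → E c a → Maps E f b s → Maps E f c s' → E s q → E s' q →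
      IsUnionClosure E q f b zb → IsUnionClosure E q f c zc →
      E t zb → E t' zc → IsUnion₂ E u x y → Le E b c → E u z := by
    intro x y b c t t' s s' zb zc u hx hy hb hc hs hs' hsq hsq' hzb hzc ht ht' hu hbc
    have hco := hao.mem hc
    have ht1 := hzb.sub_of_le hco hbc hzc t ht
    obtain ⟨v, hv, hvu⟩ := hzc.2.1.2 t t' ht1 ht'
    rcases hbc with hbc | rfl
    · have hs1 := hzc.2.2.1 b s hbc hs hsq
      obtain ⟨v', hv', hvu'⟩ := hzc.2.1.2 v s hv hs1
      refine hmem hc hzc hv' hs' hsq' fun p => ?_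
      rw [hu, hx, hy, hvu', hvu]
      tauto
    · obtain rfl := hf _ _ _ hs hs'
      refine hmem hc hzc hv hs' hsq' fun p => ?_
      rw [hu, hx, hy, hvu]
      tauto
  refine ⟨z, ⟨hzq, ⟨⟨e, (hz e).2 ⟨heq, Or.inl he⟩, he⟩, fun x y hx hy => ?_⟩,
    fun i x hi hx hxq => ?_, fun c hc hfc x hx => ?_⟩, ?_⟩
  · obtain ⟨u, huq, hu⟩ := hq.2 x y (hzq x hx) (hzq y hy)
    refine ⟨u, ?_, hu⟩
    obtain ⟨-, hx0 | ⟨b, hb, zb, t, s, hzb, ht, hs, hsq, hxu⟩⟩ := (hz x).1 hx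
    · rwa [hM.ext (x := u) (y := y) fun p => (hu p).trans (or_iff_right (hx0 p))]
    obtain ⟨-, hy0 | ⟨c, hc, zc, t', s', hzc, ht', hs', hsq', hyu⟩⟩ := (hz y).1 hy
    · rwa [hM.ext (x := u) (y := x) fun p => (hu p).trans (or_iff_left (hy0 p))]
    rcases (hao.mem hb).le_total hM (hao.mem hc) with h | h
    · exact hunion hxu hyu hb hc hs hs' hsq hsq' hzb hzc ht ht' hu h
    · exact hunion hyu hxu hc hb hs' hs hsq' hsq hzc hzb ht' ht
        (fun p => (hu p).trans or_comm) h
  · obtain ⟨z', hz', -⟩ := ih i hi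
    exact hmem hi hz' (hz'.2.1.empty_mem hM he) hx hxq fun p => (or_iff_right (he p)).symm
  · obtain ⟨-, hx0 | ⟨b, hb, zb, t, s, hzb, ht, hs, hsq, hxu⟩⟩ := (hz x).1 hx
    · exact hc.empty_mem hM hx0
    · refine hc.mem hM (hzb.2.2.2 c hc (fun i x hi => hfc i x (hao.mem_trans hb hi)) t ht)
        (hfc b s hb hs hsq) hxu
  · obtain ⟨i₀, -, hi₀, -⟩ := hw.exists_pair_ne hM hr hwr
    have h1 : Covers E r fun x => ∃ b, E b a ∧ ∃ z t y,
        IsUnionClosure E q f b z ∧ E t z ∧ Maps E f b y ∧ E y q ∧ IsUnion₂ E x t y := by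
      refine Covers.iUnion hM (X := q) (hw.square hM hr hwr)
        ((hM.covers_refl r).mono (ha.sub hr)) ?_ ?_
      · rintro b x hb ⟨zb, t, s, hzb, ht, hs, hsq, hxu⟩
        exact hzq x (hmem hb hzb ht hs hsq hxu)
      · intro b hb
        obtain ⟨zb, hzb, hcov⟩ := ih b hb
        refine hcov.image hM (fun t x => ∃ y, Maps E f b y ∧ IsUnion₂ E x t y) ?_ ?_
        · rintro t x x' - ⟨y, hy, hx⟩ ⟨y', hy', hx'⟩
          obtain rfl := hf _ _ _ hy hy'
          exact hM.ext fun p => (hx p).trans (hx' p).symm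
        · rintro x ⟨zb', t, s, hzb', ht, hs, -, hxu⟩
          obtain rfl := huniq hzb hzb'
          exact ⟨t, ht, s, hs, hxu⟩
    refine (hw.covers_or hM hr hwr (hM.covers_eq e hi₀) h1).mono fun x hx => ?_
    rcases ((hz x).1 hx).2 with h | h
    · exact Or.inl (hM.ext fun p => iff_of_false (h p) (he p))
    · exact Or.inr h

/-- A family of size at most `r` generates a union-closed family of size at most `r`. -/
theorem IsOmega.exists_unionClosed {w r q x : M} (hw : IsOmega E w) (hr : IsOrd E r)
    (hwr : Le E w r) (hq : UnionClosed E q) (hxq : Sub E x q)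
    (hx : Covers E r fun z => E z x) :
    ∃ y, Sub E x y ∧ Sub E y q ∧ UnionClosed E y ∧ Covers E r fun z => E z y := by
  obtain ⟨f, hf, hf'⟩ := hx
  obtain ⟨y, hy, hcov⟩ := hw.exists_isUnionClosure hM hr hwr hq hf
  refine ⟨y, fun z hz => ?_, hy.1, hy.2.1, hcov⟩
  obtain ⟨i, hi, hiz⟩ := hf' z hz
  exact hy.2.2.1 i z hi hiz (hxq z hz)

/-- A countable family without a bound in the union-closed family `q` is dominated by a chain of
order type `ω` in `q`. -/
theorem IsOmega.exists_chain {w q x : M} (hw : IsOmega E w) (hq : UnionClosed E q)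
    (hxq : Sub E x q) (hx : Covers E w fun z => E z x)
    (hub : ∀ y, E y q → ∃ z, E z x ∧ ¬ Sub E z y) :
    ∃ Y, Sub E Y q ∧ IsDirectedFamily E Y ∧ HasCard E Y w ∧
      (∀ z, E z x → ∃ y, E y Y ∧ Sub E z y) ∧ IsoToOrdinal E Y w := by
  obtain ⟨f, hf, hf'⟩ := hx
  have hwo := hw.1.1
  -- The union of the members of `x` enumerated before stage `n` stays in `q`, since each successor
  -- stage adds at most one set.
  have hU : ∀ n, E n w → ∃ y, E y q ∧
      ∀ z, E z y ↔ ∃ i t, E i n ∧ Maps E f i t ∧ E t x ∧ E z t := by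
    intro n hn
    refine hM.ord_induction (fun n => E n w → ∃ y, E y q ∧
      ∀ z, E z y ↔ ∃ i t, E i n ∧ Maps E f i t ∧ E t x ∧ E z t) (hwo.mem hn)
      (fun n _ ih hn => ?_) hn
    rcases hw.empty_or_succ hM hn with h | ⟨m, hm, hnm⟩
    · obtain ⟨e, heq, he⟩ := hq.1
      exact ⟨e, heq, fun z => iff_of_false (he z) fun ⟨i, _, hi, _⟩ => h i hi⟩
    · obtain ⟨y, hyq, hy⟩ := ih m ((hnm m).2 (Or.inr rfl)) hm
      by_cases ht : ∃ t, Maps E f m t ∧ E t x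
      · obtain ⟨t, hmt, htx⟩ := ht
        obtain ⟨u, huq, hu⟩ := hq.2 y t hyq (hxq t htx)
        refine ⟨u, huq, fun z => ?_⟩
        rw [hu, hy]
        constructor
        · rintro (⟨i, s, hi, h⟩ | h)
          · exact ⟨i, s, (hnm i).2 (Or.inl hi), h⟩
          · exact ⟨m, t, (hnm m).2 (Or.inr rfl), hmt, htx, h⟩
        · rintro ⟨i, s, hi, his, hsx, hzs⟩
          rcases (hnm i).1 hi with hi | rfl
          · exact Or.inl ⟨i, s, hi, his, hsx, hzs⟩
          · obtain rfl := hf _ _ _ his hmt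
            exact Or.inr hzs
      · refine ⟨y, hyq, fun z => ?_⟩
        rw [hy]
        constructor
        · rintro ⟨i, s, hi, h⟩
          exact ⟨i, s, (hnm i).2 (Or.inl hi), h⟩
        · rintro ⟨i, s, hi, his, hsx, hzs⟩
          rcases (hnm i).1 hi with hi | rfl
          · exact ⟨i, s, hi, his, hsx, hzs⟩
          · exact absurd ⟨s, his, hsx⟩ ht
  obtain ⟨Y, hY⟩ := hM.sep (fun y => ∃ n, E n w ∧
    ∀ z, E z y ↔ ∃ i t, E i n ∧ Maps E f i t ∧ E t x ∧ E z t) q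
  have hmono : ∀ {m n y y'}, E n w → Le E m n →
      (∀ z, E z y ↔ ∃ i t, E i m ∧ Maps E f i t ∧ E t x ∧ E z t) →
      (∀ z, E z y' ↔ ∃ i t, E i n ∧ Maps E f i t ∧ E t x ∧ E z t) → Sub E y y' := by
    intro m n y y' hn hmn hy hy' z hz
    obtain ⟨i, t, hi, h⟩ := (hy z).1 hz
    exact (hy' z).2 ⟨i, t, hmn.mem (hwo.mem hn) hi, h⟩
  have hanti : ∀ {y y'}, Sub E y y' → Sub E y' y → y = y' :=
    fun h h' => hM.ext fun z => ⟨h z, h' z⟩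
  have hchain : ∀ y y', E y Y → E y' Y → Sub E y y' ∨ Sub E y' y := by
    intro y y' hy hy'
    obtain ⟨-, n, hn, hy⟩ := (hY y).1 hy
    obtain ⟨-, n', hn', hy'⟩ := (hY y').1 hy'
    rcases (hwo.mem hn).le_total hM (hwo.mem hn') with h | h
    · exact Or.inl (hmono hn' h hy hy')
    · exact Or.inr (hmono hn h hy' hy)
  have hWO : IsWellOrderOn E Y fun y y' => Sub E y y' ∧ y ≠ y' := by
    refine ⟨fun s hs => ?_, fun a b c _ _ _ hab hbc => ?_, fun a b ha hb hne => ?_⟩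
    · rintro ⟨y₀, hy₀⟩
      obtain ⟨-, n₀, hn₀, hy₀'⟩ := (hY y₀).1 (hs y₀ hy₀)
      obtain ⟨n, hnn, ⟨hn, y, hy, hy'⟩, hmin⟩ := hM.exists_least (fun n => E n w ∧ ∃ y, E y s ∧
        ∀ z, E z y ↔ ∃ i t, E i n ∧ Maps E f i t ∧ E t x ∧ E z t) (hwo.mem hn₀)
        ⟨hn₀, y₀, hy₀, hy₀'⟩
      refine ⟨y, hy, fun z hz hzy => ?_⟩
      obtain ⟨-, m, hm, hz'⟩ := (hY z).1 (hs z hz)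
      rcases (hwo.mem hm).lt_or_le hM (hwo.mem hn) with h | h
      · exact hmin m h ⟨hm, z, hz, hz'⟩
      · exact hzy.2 (hanti hzy.1 (hmono hm h hy' hz'))
    · refine ⟨fun z hz => hbc.1 z (hab.1 z hz), ?_⟩
      rintro rfl
      exact hab.2 (hanti hab.1 hbc.1)
    · rcases hchain a b ha hb with h | h
      · exact Or.inl ⟨h, hne⟩
      · exact Or.inr ⟨h, hne.symm⟩
  have hsubY : ∀ z, E z x → ∃ y, E y Y ∧ Sub E z y := by
    intro z hz
    obtain ⟨i, hi, hiz⟩ := hf' z hz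
    obtain ⟨n, hn⟩ := hM.exists_succ i
    have hnw := hw.1.succ_mem hM hi hn
    obtain ⟨y, hyq, hy⟩ := hU n hnw
    exact ⟨y, (hY y).2 ⟨hyq, n, hnw, hy⟩, fun p hp =>
      (hy p).2 ⟨i, z, (hn i).2 (Or.inr rfl), hiz, hz, hp⟩⟩
  have hYne : ∃ y, E y Y := by
    obtain ⟨e, heq, -⟩ := hq.1
    obtain ⟨z, hz, -⟩ := hub e heq
    obtain ⟨y, hy, -⟩ := hsubY z hz
    exact ⟨y, hy⟩
  obtain ⟨T, g, hT, hg, hgR⟩ := hWO.exists_ordinal hM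
  -- A nonzero finite order type would give a largest member of `Y`, bounding `x` in `q`. Beyond
  -- `ω`, the member in position `ω` is some stage `n`, and its infinitely many predecessors would
  -- all be stages before `n`.
  have hTw : T = w := by
    rcases hT.trichotomy hM hwo with h | h | h
    · exfalso
      rcases hw.empty_or_succ hM h with h | ⟨m, -, hm⟩
      · obtain ⟨y, hy⟩ := hYne
        obtain ⟨i, hi, -⟩ := hg.2.2 y hy
        exact h i hi
      · have hmT : E m T := (hm m).2 (Or.inr rfl)
        obtain ⟨y, hy, hmy⟩ := hg.1.exists_maps hM hmT
        obtain ⟨z, hz, hzy⟩ := hub y ((hY y).1 hy).1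
        obtain ⟨y', hy', hzy'⟩ := hsubY z hz
        obtain ⟨i, hi, hiy'⟩ := hg.2.2 y' hy'
        refine hzy fun p hp => ?_
        rcases (hm i).1 hi with hi | rfl
        · exact ((hgR i m y' y hiy' hmy).1 hi).1 p (hzy' p hp)
        · obtain rfl := hg.1.maps_unique hM hmy hiy'
          exact hzy' p hp
    · exact h
    · exfalso
      obtain ⟨y, hy, hwy⟩ := hg.1.exists_maps hM h
      obtain ⟨-, n, hn, hy'⟩ := (hY y).1 hy
      refine hw.not_covers hM hn ((hM.covers_refl n).image hM (fun m i => ∃ z, Maps E g i z ∧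
        ∀ p, E p z ↔ ∃ i t, E i m ∧ Maps E f i t ∧ E t x ∧ E p t) ?_ ?_)
      · rintro m i i' - ⟨z, hz, hz'⟩ ⟨z₁, hz₁, hz₁'⟩
        obtain rfl : z = z₁ := hM.ext fun p => (hz' p).trans (hz₁' p).symm
        exact hg.2.1 _ _ _ hz hz₁
      · intro i hi
        obtain ⟨z, hz, hiz⟩ := hg.1.exists_maps hM (hT.mem_trans h hi)
        obtain ⟨hzy, hne⟩ := (hgR i w z y hiz hwy).1 hi
        obtain ⟨-, m, hm, hz'⟩ := (hY z).1 hz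
        refine ⟨m, ?_, z, hiz, hz'⟩
        rcases (hwo.mem hm).lt_or_le hM (hwo.mem hn) with h' | h'
        · exact h'
        · exact absurd (hanti hzy (hmono hm h' hy' hz')) hne
  subst hTw
  refine ⟨Y, fun y hy => ((hY y).1 hy).1, ⟨hYne, fun a b ha hb => ?_⟩,
    ⟨⟨hwo, ?_⟩, g, hg⟩, hsubY, g, hg, fun m n y y' hy hy' => ⟨?_, fun h => ?_⟩⟩
  · rcases hchain a b ha hb with h | h
    · exact ⟨b, hb, h, fun z hz => hz⟩
    · exact ⟨a, ha, fun z hz => hz, h⟩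
  · rintro a ha ⟨k, hk⟩
    exact hw.not_covers hM ha (hk.covers hM)
  · rintro (h | rfl)
    · exact ((hgR m n y y' hy hy').1 h).1
    · rw [hg.1.maps_unique hM hy hy']
      exact fun z hz => hz
  · by_cases hne : y = y'
    · subst hne
      exact Or.inr (hg.2.1 _ _ _ hy hy')
    · exact Or.inl ((hgR m n y y' hy hy').2 ⟨h, hne⟩)

end Unions

/-! ### Absoluteness between the inner model and `W` -/

section InnerModel

variable {W : Type*} {E : W → W → Prop} {V : Set W}

variable (hV : IsInnerModel E V)
include hV

theorem IsInnerModel.sub_iff {a b : V} : Sub (restr E V) a b ↔ Sub E (a : W) b :=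
  ⟨fun h z hz => h ⟨z, hV.transitive a z a.2 hz⟩ hz, fun h z hz => h z hz⟩

theorem IsInnerModel.isTrans_iff {a : V} : IsTrans (restr E V) a ↔ IsTrans E (a : W) :=
  ⟨fun h y hy => (hV.sub_iff (a := ⟨y, hV.transitive a y a.2 hy⟩)).1 (h _ hy),
    fun h y hy => hV.sub_iff.2 (h y hy)⟩

theorem IsInnerModel.isOrd_iff {a : V} : IsOrd (restr E V) a ↔ IsOrd E (a : W) :=
  and_congr hV.isTrans_iff
    ⟨fun h y hy => (hV.isTrans_iff (a := ⟨y, hV.transitive a y a.2 hy⟩)).1 (h _ hy),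
      fun h y hy => hV.isTrans_iff.2 (h y hy)⟩

theorem IsInnerModel.isLimitOrd_iff {a : V} : IsLimitOrd (restr E V) a ↔ IsLimitOrd E (a : W) := by
  have hmem : ∀ y, E y a → y ∈ V := fun y hy => hV.transitive a y a.2 hy
  refine and_congr hV.isOrd_iff (and_congr ⟨fun ⟨y, hy⟩ => ⟨y, hy⟩,
    fun ⟨y, hy⟩ => ⟨⟨y, hmem y hy⟩, hy⟩⟩ ⟨fun h y hy => ?_, fun h y hy => ?_⟩)
  · obtain ⟨z, hz⟩ := h ⟨y, hmem y hy⟩ hy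
    exact ⟨z, hz⟩
  · obtain ⟨z, hz⟩ := h y hy
    exact ⟨⟨z, hmem z hz.1⟩, hz⟩

theorem IsInnerModel.isUPair_iff {z a b : V} :
    IsUPair (restr E V) z a b ↔ IsUPair E (z : W) a b := by
  refine ⟨fun h w => ⟨fun hw => ?_, ?_⟩, fun h w => ?_⟩
  · simpa [Subtype.ext_iff] using (h ⟨w, hV.transitive z w z.2 hw⟩).1 hw
  · rintro (rfl | rfl)
    · exact (h a).2 (Or.inl rfl)
    · exact (h b).2 (Or.inr rfl)
  · simp only [restr, Subtype.ext_iff]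
    exact h w

variable (hW : IsModelZFC E)
include hW

/-- The pair formed in `V` is, by transitivity, also the pair in `W`, and extensionality identifies
the two. -/
theorem IsInnerModel.upair_mem {z : W} {a b : V} (h : IsUPair E z a b) : z ∈ V := by
  obtain ⟨z', hz'⟩ := hV.zfc.pairing a b
  rw [hV.isUPair_iff] at hz'
  rw [hW.ext fun w => (h w).trans (hz' w).symm]
  exact z'.2

theorem IsInnerModel.isOPair_iff {p a b : V} :
    IsOPair (restr E V) p a b ↔ IsOPair E (p : W) a b := by
  refine ⟨fun h z => ⟨fun hz => ?_, fun hz => ?_⟩, fun h z => ?_⟩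
  · have := (h ⟨z, hV.transitive p z p.2 hz⟩).1 hz
    rwa [hV.isUPair_iff, hV.isUPair_iff] at this
  · have hzV : z ∈ V := hz.elim (hV.upair_mem hW) (hV.upair_mem hW)
    refine (h ⟨z, hzV⟩).2 ?_
    rwa [hV.isUPair_iff, hV.isUPair_iff]
  · rw [hV.isUPair_iff, hV.isUPair_iff]
    exact h z

theorem IsInnerModel.maps_iff {f a b : V} : Maps (restr E V) f a b ↔ Maps E (f : W) a b := by
  constructor
  · rintro ⟨p, hp, hpf⟩
    exact ⟨p, (hV.isOPair_iff hW).1 hp, hpf⟩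
  · rintro ⟨p, hp, hpf⟩
    exact ⟨⟨p, hV.transitive f p f.2 hpf⟩, (hV.isOPair_iff hW).2 hp, hpf⟩

theorem IsInnerModel.mem_of_maps {f : V} {a b : W} (h : Maps E (f : W) a b) :
    a ∈ V ∧ b ∈ V := by
  obtain ⟨p, hp, hpf⟩ := h
  have hpV := hV.transitive f p f.2 hpf
  obtain ⟨z, hz⟩ := hW.pairing a b
  have hzp := (hp z).2 (Or.inr hz)
  have hzV := hV.transitive p z hpV hzp
  exact ⟨hV.transitive z a hzV ((hz a).2 (Or.inl rfl)),
    hV.transitive z b hzV ((hz b).2 (Or.inr rfl))⟩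

theorem IsInnerModel.singleValued {f : V} (h : SingleValued (restr E V) f) :
    SingleValued E (f : W) := by
  intro x y y' hy hy'
  obtain ⟨hx, hyV⟩ := hV.mem_of_maps hW hy
  obtain ⟨-, hyV'⟩ := hV.mem_of_maps hW hy'
  have := h ⟨x, hx⟩ ⟨y, hyV⟩ ⟨y', hyV'⟩ ((hV.maps_iff hW).2 hy) ((hV.maps_iff hW).2 hy')
  simpa using this

theorem IsInnerModel.cofinalFrom {t a : V} (h : CofinalFrom (restr E V) t a) :
    CofinalFrom E (t : W) a := by
  obtain ⟨f, hf, hf'⟩ := h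
  refine ⟨f, hV.singleValued hW hf, fun z hz => ?_⟩
  obtain ⟨i, y, hi, hy, hiy, hzy⟩ := hf' ⟨z, hV.transitive a z a.2 hz⟩ hz
  exact ⟨i, y, hi, hy, (hV.maps_iff hW).1 hiy, hzy⟩

end InnerModel

/-! ### Covering an ordinal by few members of a family -/

section CoveringFamilies

variable {M : Type*} {E : M → M → Prop}

/-- The ordinal `n` is covered by the union of at most `t` members of `q`. -/
def CoveredBy (E : M → M → Prop) (q t n : M) : Prop :=
  ∃ Z, Sub E Z q ∧ (Covers E t fun y => E y Z) ∧ ∀ x, E x n → ∃ y, E y Z ∧ E x y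

instance Dfn.CoveredBy (t s r : (ℕ → M) → M) [IsTerm t] [IsTerm s] [IsTerm r] :
    Dfn E fun v => CoveredBy E (t v) (s v) (r v) := by
  unfold ModelST.CoveredBy; infer_instance

variable (hM : IsModelZFC E)
include hM

theorem CoveredBy.of_mem {q t n e : M} (he : E e t) (hn : E n q) : CoveredBy E q t n := by
  obtain ⟨Z, hZ⟩ := hM.exists_singleton n
  refine ⟨Z, fun z hz => ?_, (hM.covers_eq n he).mono fun z hz => (hZ z).1 hz,
    fun x hx => ⟨n, (hZ n).2 rfl, hx⟩⟩
  rwa [(hZ z).1 hz]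

/-- Serves two purposes: transfer along a bijection in `V` when the ordinal is not a cardinal there,
and, with the identity of `ν`, intersection of a covering with `ν`. -/
theorem CoveredBy.image {q q' t a n f : M} (h : CoveredBy E q t a)
    (hf : ∀ z, E z n → ∃ x, E x a ∧ Maps E f x z)
    (hq : ∀ y, E y q → ∃ y', E y' q' ∧ ∀ z, E z y' ↔ ∃ x, E x y ∧ Maps E f x z) :
    CoveredBy E q' t n := by
  obtain ⟨Z, hZq, hZ, hZa⟩ := h
  obtain ⟨Z', hZ'⟩ := hM.sep
    (fun y' => ∃ y, E y Z ∧ ∀ z, E z y' ↔ ∃ x, E x y ∧ Maps E f x z) q'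
  refine ⟨Z', fun z hz => ((hZ' z).1 hz).1, ?_, fun z hz => ?_⟩
  · exact hZ.image hM (fun y y' => ∀ z, E z y' ↔ ∃ x, E x y ∧ Maps E f x z)
      (fun y y' y'' _ h h' => hM.ext fun z => (h z).trans (h' z).symm)
      (fun z hz => ((hZ' z).1 hz).2)
  · obtain ⟨x, hx, hxz⟩ := hf z hz
    obtain ⟨y, hy, hxy⟩ := hZa x hx
    obtain ⟨y', hy'q, hy'⟩ := hq y (hZq y hy)
    exact ⟨y', (hZ' y').2 ⟨hy'q, y, hy, hy'⟩, (hy' z).2 ⟨x, hxy, hxz⟩⟩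

/-- A covering of each of the `t` many values of the cofinal map is chosen; together they contain at
most `t · t = t` sets. -/
theorem CoveredBy.of_cofinalFrom {q t n : M}
    (ht : Covers E t fun p => ∃ a b, E a t ∧ E b t ∧ IsOPair E p a b)
    (hn : CofinalFrom E t n) (h : ∀ a, E a n → CoveredBy E q t a) : CoveredBy E q t n := by
  obtain ⟨g, hg, hg'⟩ := hn
  obtain ⟨B, hB⟩ := hM.powerset q
  obtain ⟨a, ha⟩ := hM.sep (fun i => ∃ y, E y n ∧ Maps E g i y) t
  obtain ⟨F, hF, hF'⟩ := hM.exists_choice a B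
    (fun i Z => Sub E Z q ∧ (Covers E t fun y => E y Z) ∧
      ∀ b, Maps E g i b → ∀ x, E x b → ∃ y, E y Z ∧ E x y) (by
    intro i hi
    obtain ⟨-, b, hb, hib⟩ := (ha i).1 hi
    obtain ⟨Z, hZq, hZ, hZb⟩ := h b hb
    refine ⟨Z, (hB Z).2 hZq, hZq, hZ, fun b' hb' => ?_⟩
    obtain rfl := hg _ _ _ hib hb'
    exact hZb)
  obtain ⟨U, hU⟩ := hM.sep (fun y => ∃ i, E i a ∧ ∃ Z, Maps E F i Z ∧ E y Z) q
  refine ⟨U, fun y hy => ((hU y).1 hy).1, ?_, fun x hx => ?_⟩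
  · refine (Covers.iUnion hM (I := fun i => E i a) (Q := fun i y => ∃ Z, Maps E F i Z ∧ E y Z)
      (X := q) ht ((hM.covers_refl t).mono fun i hi => ((ha i).1 hi).1) ?_ ?_).mono
      fun y hy => ((hU y).1 hy).2
    · rintro i y hi ⟨Z, hZ, hy⟩
      obtain ⟨Z', hZ', hq, -⟩ := hF' i hi
      obtain rfl := hF _ _ _ hZ hZ'
      exact hq y hy
    · intro i hi
      obtain ⟨Z, hZ, -, hc, -⟩ := hF' i hi
      refine hc.mono ?_
      rintro y ⟨Z', hZ', hy⟩
      obtain rfl := hF _ _ _ hZ hZ'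
      exact hy
  · obtain ⟨i, y, hi, hy, hiy, hxy⟩ := hg' x hx
    have hia := (ha i).2 ⟨hi, y, hy, hiy⟩
    obtain ⟨Z, hZ, hZq, -, hcov⟩ := hF' i hia
    obtain ⟨u, hu, hxu⟩ := hcov y hiy x hxy
    exact ⟨u, (hU u).2 ⟨hZq u hu, i, hia, Z, hZ, hu⟩, hxu⟩

/-- A covering of `n` by at most `t` members of the union-closed family `q` of subsets of `n` can
be refined to a directed family of size exactly `t`. -/
theorem CoveredBy.exists_directed {w q t n : M} (hw : IsOmega E w) (ht : IsCard E t)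
    (hwt : Le E w t) (hqn : ∀ y, E y q → Sub E y n) (hq : UnionClosed E q) (htn : Sub E t n)
    (hsing : ∀ a y, E a n → (∀ z, E z y ↔ z = a) → E y q) (hn : ¬ E n q)
    (h : CoveredBy E q t n) :
    ∃ Y, Sub E Y q ∧ IsDirectedFamily E Y ∧ HasCard E Y t ∧ IsUnionOf E n Y ∧
      (IsOmega E t → IsoToOrdinal E Y t) := by
  obtain ⟨Z, hZq, hZ, hZn⟩ := h
  by_cases hto : IsOmega E t
  · obtain ⟨Y, hYq, hYd, hYc, hY, hYi⟩ := hto.exists_chain hM hq hZq hZ (by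
      intro y hy
      by_contra hcon
      push Not at hcon
      refine hn ?_
      rwa [hM.ext (x := n) (y := y) fun z => ⟨fun hz => ?_, fun hz => hqn y hy z hz⟩]
      obtain ⟨u, hu, hzu⟩ := hZn z hz
      exact hcon u hu z hzu)
    refine ⟨Y, hYq, hYd, hYc, fun z => ⟨fun hz => ?_, ?_⟩, fun _ => hYi⟩
    · obtain ⟨u, hu, hzu⟩ := hZn z hz
      obtain ⟨y, hy, huy⟩ := hY u hu
      exact ⟨y, hy, huy z hzu⟩
    · rintro ⟨y, hy, hz⟩
      exact hqn y (hYq y hy) z hz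
  obtain ⟨e, _, he, -⟩ := hw.exists_pair_ne hM ht.1 hwt
  -- The singletons of elements of `t` are added to force the size of the closure up to `t`.
  obtain ⟨Z', hZ'⟩ := hM.sep (fun y => E y Z ∨ ∃ a, E a t ∧ ∀ z, E z y ↔ z = a) q
  obtain ⟨Y, hZY, hYq, hYu, hY⟩ := hw.exists_unionClosed hM ht.1 hwt hq
    (fun y hy => ((hZ' y).1 hy).1)
    ((hw.covers_or hM ht.1 hwt hZ ((hM.covers_refl t).image hM (fun a y => ∀ z, E z y ↔ z = a)
      (fun a y y' _ h h' => hM.ext fun z => (h z).trans (h' z).symm)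
      (fun y hy => hy))).mono fun y hy => ((hZ' y).1 hy).2)
  refine ⟨Y, hYq, ⟨hYu.1.imp fun _ h => h.1, fun a b ha hb => ?_⟩, ?_, fun z => ⟨fun hz => ?_, ?_⟩,
    fun h => absurd h hto⟩
  · obtain ⟨c, hc, hcu⟩ := hYu.2 a b ha hb
    exact ⟨c, hc, fun z hz => (hcu z).2 (Or.inl hz), fun z hz => (hcu z).2 (Or.inr hz)⟩
  · obtain ⟨c, hc, hcard⟩ := hY.exists_hasCard hM ht.1
    rcases hc with hc | rfl
    · exfalso
      obtain ⟨-, f, hf⟩ := hcard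
      refine ht.not_covers hM hc ((hf.covers hM).image hM (fun y a => ∀ z, E z y ↔ z = a) ?_ ?_)
      · intro y a a' _ h h'
        exact (h' a).1 ((h a).2 rfl)
      · intro a ha
        obtain ⟨y, hy⟩ := hM.exists_singleton a
        exact ⟨y, hZY y ((hZ' y).2 ⟨hsing a y (htn a ha) hy, Or.inr ⟨a, ha, hy⟩⟩), hy⟩
    · exact hcard
  · obtain ⟨u, hu, hzu⟩ := hZn z hz
    exact ⟨u, hZY u ((hZ' u).2 ⟨hZq u hu, Or.inl hu⟩), hzu⟩
  · rintro ⟨y, hy, hz⟩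
    exact hqn y (hYq y hy) z hz

end CoveringFamilies

/-! ### The family of small subsets of an ordinal -/

section SmallSubsets

variable {M : Type*} {E : M → M → Prop}

/-- `q` is the set of all subsets of `l` of size less than `k`. -/
def IsSmallSubsets (E : M → M → Prop) (k l q : M) : Prop :=
  ∀ x, E x q ↔ Sub E x l ∧ Small E k x

instance Dfn.Small (t s : (ℕ → M) → M) [IsTerm t] [IsTerm s] :
    Dfn E fun v => Small E (t v) (s v) := by
  unfold ModelST.Small; infer_instance

variable (hM : IsModelZFC E)
include hM

theorem IsModelZFC.exists_smallSubsets (k l : M) : ∃ q, IsSmallSubsets E k l q := by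
  obtain ⟨P, hP⟩ := hM.powerset l
  obtain ⟨q, hq⟩ := hM.sep (fun x => Small E k x) P
  exact ⟨q, fun x => by rw [hq, hP]⟩

theorem IsSmallSubsets.unionClosed {w k l q : M} (hq : IsSmallSubsets E k l q)
    (hw : IsOmega E w) (hk : IsOrd E k) (hwk : E w k) : UnionClosed E q := by
  obtain ⟨e, he⟩ := hM.exists_empty
  refine ⟨⟨e, (hq e).2 ⟨fun z hz => absurd hz (he z), w, hwk,
    (hM.covers_refl w).mono fun z hz => absurd hz (he z)⟩, he⟩, fun x y hx hy => ?_⟩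
  obtain ⟨u, hu⟩ := hM.exists_union₂ x y
  rw [hq] at hx hy
  refine ⟨u, (hq u).2 ⟨fun z hz => ?_, hw.small_union hM hk hwk hx.2 hy.2 hu⟩, hu⟩
  rcases (hu z).1 hz with h | h
  · exact hx.1 z h
  · exact hy.1 z h

theorem IsSmallSubsets.mem_of_mem {k l q a : M} (hq : IsSmallSubsets E k l q) (ha : E a k)
    (hal : Sub E a l) : E a q :=
  (hq a).2 ⟨hal, a, ha, hM.covers_refl a⟩

theorem IsSmallSubsets.singleton_mem {e d k l q a y : M} (hq : IsSmallSubsets E k l q)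
    (hd : E d k) (he : E e d) (ha : E a l) (hy : ∀ z, E z y ↔ z = a) : E y q := by
  refine (hq y).2 ⟨fun z hz => ?_, d, hd, (hM.covers_eq a he).mono fun z hz => (hy z).1 hz⟩
  rwa [(hy z).1 hz]

theorem IsSmallSubsets.exists_image {k l l' q q' f y : M} (hq : IsSmallSubsets E k l q)
    (hq' : IsSmallSubsets E k l' q') (hf : SingleValued E f)
    (hfl : ∀ x z, Maps E f x z → E z l') (hy : E y q) :
    ∃ y', E y' q' ∧ ∀ z, E z y' ↔ ∃ x, E x y ∧ Maps E f x z := by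
  obtain ⟨y', hy'⟩ := hM.sep (fun z => ∃ x, E x y ∧ Maps E f x z) l'
  obtain ⟨-, d, hd, hc⟩ := (hq y).1 hy
  refine ⟨y', (hq' y').2 ⟨fun z hz => ((hy' z).1 hz).1, d, hd, hc.image hM (Maps E f)
    (fun x z z' _ h h' => hf x z z' h h') fun z hz => ((hy' z).1 hz).2⟩, fun z => ?_⟩
  rw [hy', and_iff_right_of_imp]
  rintro ⟨x, -, hxz⟩
  exact hfl x z hxz

theorem IsSmallSubsets.not_self_mem {k l q : M} (hq : IsSmallSubsets E k l q)
    (hl : IsCard E l) (hkl : Le E k l) : ¬ E l q := by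
  intro h
  obtain ⟨-, d, hd, hc⟩ := (hq l).1 h
  exact hl.not_covers hM (hkl.mem hl.1 hd) hc

end SmallSubsets

/-! ### Covering ordinals by `V`-small sets -/

section InnerModelSmallSubsets

variable {W : Type*} {E : W → W → Prop} {V : Set W} (hV : IsInnerModel E V)
include hV

theorem IsInnerModel.unionClosed {q : V} (hq : UnionClosed (restr E V) q) :
    UnionClosed E (q : W) := by
  have hq' : ∀ x, E x q → x ∈ V := fun x hx => hV.transitive q x q.2 hx
  obtain ⟨⟨e, heq, he⟩, hu⟩ := hq
  refine ⟨⟨e, heq, fun z hz => he ⟨z, hV.transitive e z e.2 hz⟩ hz⟩, fun x y hx hy => ?_⟩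
  obtain ⟨u, huq, hu⟩ := hu ⟨x, hq' x hx⟩ ⟨y, hq' y hy⟩ hx hy
  refine ⟨u, huq, fun z => ⟨fun hz => ?_, ?_⟩⟩
  · exact (hu ⟨z, hV.transitive u z u.2 hz⟩).1 hz
  · rintro (h | h)
    · exact (hu ⟨z, hV.transitive x z (hq' x hx) h⟩).2 (Or.inl h)
    · exact (hu ⟨z, hV.transitive y z (hq' y hy) h⟩).2 (Or.inr h)

variable (hW : IsModelZFC E)
include hW

theorem IsInnerModel.exists_image {k l l' q q' f : V} (hq : IsSmallSubsets (restr E V) k l q)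
    (hq' : IsSmallSubsets (restr E V) k l' q') (hf : SingleValued (restr E V) f)
    (hfl : ∀ x z, Maps (restr E V) f x z → restr E V z l') (y : W) (hy : E y q) :
    ∃ y', E y' q' ∧ ∀ z, E z y' ↔ ∃ x, E x y ∧ Maps E f x z := by
  have hyV := hV.transitive q y q.2 hy
  obtain ⟨y', hy'q, hy'⟩ := hq.exists_image hV.zfc hq' hf hfl (y := ⟨y, hyV⟩) hy
  refine ⟨y', hy'q, fun z => ⟨fun hz => ?_, ?_⟩⟩
  · obtain ⟨x, hx, hxz⟩ := (hy' ⟨z, hV.transitive y' z y'.2 hz⟩).1 hz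
    exact ⟨x, hx, (hV.maps_iff hW).1 hxz⟩
  · rintro ⟨x, hx, hxz⟩
    obtain ⟨hxV, hzV⟩ := hV.mem_of_maps hW hxz
    exact (hy' ⟨z, hzV⟩).2 ⟨⟨x, hxV⟩, hx, (hV.maps_iff hW).2 hxz⟩

/-- Every ordinal below `lam` is covered by `θ` many sets that are small in the inner model. -/
theorem IsInnerModel.coveredBy {w θ κ lam τ μ q : V}
    (hθ : IsRegularCard (restr E V) θ) (hκ : IsRegularCard (restr E V) κ)
    (hlam : IsCard (restr E V) lam) (hθκ : restr E V θ κ)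
    (hτ : IsSuccCard (restr E V) τ θ) (hμ : IsCardShift (restr E V) κ τ μ)
    (hle : Le (restr E V) lam μ)
    (hcof : ∀ ν : V, IsRegularCard (restr E V) ν → Le (restr E V) κ ν → restr E V ν lam →
      HasCof E (ν : W) (θ : W))
    (hw : IsOmega (restr E V) w) (hwθ : Le (restr E V) w θ)
    (hq : IsSmallSubsets (restr E V) κ lam q) {ν : V} (hν : restr E V ν lam) :
    CoveredBy E (q : W) (θ : W) (ν : W) := by
  have hlamW : IsOrd E (lam : W) := hV.isOrd_iff.1 hlam.1
  have hθlim : IsLimitOrd E (θ : W) := hV.isLimitOrd_iff.1 hθ.2.1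
  obtain ⟨w', hw'θ, hw'⟩ := hθlim.exists_omega hW
  have hsq := hw'.square hW hθlim.1 hw'θ
  obtain ⟨e, he⟩ := hθlim.2.1
  -- The family `q` is that of the small subsets of `lam`, not of `ν`, so that it is one fixed
  -- parameter throughout the induction.
  refine hW.ord_induction (fun ν => E ν lam → CoveredBy E (q : W) (θ : W) ν) (hlamW.mem hν)
    (fun b _ ih hb => ?_) hν
  replace ih : ∀ c, E c b → CoveredBy E (q : W) (θ : W) c :=
    fun c hc => ih c hc (hlamW.mem_trans hb hc)
  have hbV := hV.transitive lam b lam.2 hb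
  obtain ⟨b, rfl⟩ : ∃ b' : V, (b' : W) = b := ⟨⟨b, hbV⟩, rfl⟩
  have hbo : IsOrd (restr E V) b := hlam.1.mem hb
  rcases hbo.lt_or_le hV.zfc hκ.1.1 with hbκ | hκb
  · exact CoveredBy.of_mem hW he (hq.mem_of_mem hV.zfc hbκ (hlam.1.1 b hb))
  by_cases hcard : IsCard (restr E V) b
  -- A cofinal map from `θ` exists in `W` if `b` is regular in `V`, by hypothesis, and already in
  -- `V` otherwise.
  · refine CoveredBy.of_cofinalFrom hW hsq ?_ ih
    rcases hμ.regular_or_cofinalFrom hV.zfc hw hwθ hθκ hκ hτ hle hcard hκb hb with h | h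
    · exact (hcof b h hκb hb).2.1.cofinalFrom hW (hV.isLimitOrd_iff.1 h.2.1)
    · exact hV.cofinalFrom hW h
  · have : ∃ a, restr E V a b ∧ ∃ f, IsBij (restr E V) f a b := by
      by_contra hcon
      exact hcard ⟨hbo, fun a ha hf => hcon ⟨a, ha, hf⟩⟩
    obtain ⟨a, ha, f, hf⟩ := this
    refine (ih a ha).image hW (f := (f : W)) (fun z hz => ?_) (hV.exists_image hW hq hq
      (fun x y y' h h' => hf.1.maps_unique hV.zfc h h') fun x z h =>
        hlam.1.mem_trans hb (hf.1.maps_mem hV.zfc h).2)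
    obtain ⟨x, hx, hxz⟩ := hf.2.2 ⟨z, hV.transitive b z b.2 hz⟩ hz
    exact ⟨x, hx, (hV.maps_iff hW).1 hxz⟩

end InnerModelSmallSubsets

end ModelST

/-! ### The main theorem -/

theorem mainTheorem10 {W : Type*} (E : W → W → Prop) (hW : ModelST.IsModelZFC E)
    (V : Set W) (hV : ModelST.IsInnerModel E V)
    (θ κ lam : V)
    (hθ : ModelST.IsRegularCard (ModelST.restr E V) θ)
    (hκ : ModelST.IsRegularCard (ModelST.restr E V) κ)
    (hlam : ModelST.IsCard (ModelST.restr E V) lam)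
    (hθκ : ModelST.restr E V θ κ) (hκlam : ModelST.restr E V κ lam)
    -- `τ = (θ⁺)^V`, `μ = (κ^{+θ⁺})^V` and `lam ≤ μ`
    (τ μ : V) (hτ : ModelST.IsSuccCard (ModelST.restr E V) τ θ)
    (hμ : ModelST.IsCardShift (ModelST.restr E V) κ τ μ)
    (hle : ModelST.Le (ModelST.restr E V) lam μ)
    (hcof : ∀ ν : V, ModelST.IsRegularCard (ModelST.restr E V) ν →
      ModelST.Le (ModelST.restr E V) κ ν → ModelST.restr E V ν lam →
        ModelST.HasCof E (ν : W) (θ : W)) :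
    ∀ ν : V, ModelST.IsCard (ModelST.restr E V) ν →
      ModelST.Le (ModelST.restr E V) κ ν → ModelST.restr E V ν lam →
        ∃ Y : W,
          (∀ y, E y Y → ∃ hy : y ∈ V, ModelST.InPk (ModelST.restr E V) κ ν ⟨y, hy⟩) ∧
          ModelST.IsDirectedFamily E Y ∧
          ModelST.HasCard E Y (θ : W) ∧
          ModelST.IsUnionOf E (ν : W) Y ∧
          (ModelST.IsOmega E (θ : W) → ModelST.IsoToOrdinal E Y (θ : W)) := by
  open ModelST in
  intro ν hν hκν hνlam
  -- The hypothesis at `ν = κ` makes `θ` a cofinality in `W`, hence a cardinal there.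
  have hθW : IsCard E (θ : W) := (hcof κ hκ (Le.refl κ) hκlam).isCard hW
  -- Here `w` is `ω` computed in `V` and `w'` is `ω` computed in `W`; each is used only in its own
  -- model, so they need not be identified.
  obtain ⟨w, hwθ, hw⟩ := hθ.2.1.exists_omega hV.zfc
  obtain ⟨w', hw'θ, hw'⟩ := (hV.isLimitOrd_iff.1 hθ.2.1).exists_omega hW
  have hwκ : restr E V w κ := hwθ.elim (hκ.1.1.mem_trans hθκ) fun h => h ▸ hθκ
  obtain ⟨q, hq⟩ := hV.zfc.exists_smallSubsets κ lam
  obtain ⟨q', hq'⟩ := hV.zfc.exists_smallSubsets κ ν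
  have hq'V : ∀ y, E y q' → y ∈ V := fun y hy => hV.transitive q' y q'.2 hy
  obtain ⟨f, hf, hf'⟩ := hV.zfc.exists_func (fun x y => x = y) ν ν (fun x hx => ⟨x, hx, rfl⟩)
    (fun _ _ _ _ _ _ h h' => h.symm.trans h')
  -- The image under the identity of `ν` replaces each small subset of `lam` by its intersection
  -- with `ν`.
  have hcov : CoveredBy E (q' : W) (θ : W) (ν : W) := by
    refine (hV.coveredBy hW hθ hκ hlam hθκ hτ hμ hle hcof hw hwθ hq hνlam).image hW
      (f := (f : W)) (fun z hz => ⟨z, hz, ?_⟩) (hV.exists_image hW hq hq'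
      (fun x y y' h h' => hf.maps_unique hV.zfc h h') fun x z h => (hf.maps_mem hV.zfc h).2)
    let z' : V := ⟨z, hV.transitive ν z ν.2 hz⟩
    exact (hV.maps_iff hW).1 ((hf' z' z').2 ⟨hz, hz, rfl⟩)
  obtain ⟨e, he⟩ := hθ.2.1.2.1
  obtain ⟨Y, hYq, hYd, hYc, hYu, hYi⟩ := hcov.exists_directed hW hw' hθW hw'θ
    (fun y hy => hV.sub_iff.1 ((hq' ⟨y, hq'V y hy⟩).1 hy).1)
    (hV.unionClosed (hq'.unionClosed hV.zfc hw hκ.1.1 hwκ))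
    (hV.sub_iff.1 (hν.1.1 θ (hκν.mem hν.1 hθκ)))
    (fun a y ha hy => by
      let a' : V := ⟨a, hV.transitive ν a ν.2 ha⟩
      have hyV : y ∈ V := hV.upair_mem hW (a := a') (b := a') fun z => (hy z).trans or_self_iff.symm
      exact hq'.singleton_mem hV.zfc (y := ⟨y, hyV⟩) (a := a') hθκ he ha fun z =>
        (hy z).trans (Subtype.ext_iff (a1 := z) (a2 := a')).symm)
    (hq'.not_self_mem hV.zfc hν hκν)
  refine ⟨Y, fun y hy => ?_, hYd, hYc, hYu, hYi⟩
  have hyV := hq'V y (hYq y hy)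
  obtain ⟨hsub, hsmall⟩ := (hq' ⟨y, hyV⟩).1 (hYq y hy)
  exact ⟨hyV, hsub, (small_iff_hasCard hV.zfc hκ.1.1).1 hsmall⟩
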